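/- Let $a\in\mathbb R$. For $\operatorname{Re}\alpha>-\tfrac12$ and $z\in\mathbb C$ let $$U(\alpha,z)=\frac{e^{-z^2/4}}{\Gamma(\frac12+\alpha)}\int_0^\infty t^{\alpha-\frac12}e^{-\frac12t^2-zt}\,dt$$ be the parabolic cylinder function, and put $$W_j(a,z)=U\big((-1)^j ia,\,(-i)^jze^{-\pi i/4}\big)\quad(j=0,3).$$ The Weber function $W(a,z)$ is $$W(a,z)=\sqrt{\tfrac12 k}\;e^{\pi a/4}\left\{e^{i\rho}W_0(a,z)+e^{-i\rho}W_3(a,z)\right\},\qquad k=\sqrt{1+e^{2\pi a}}-e^{\pi a},\quad \rho=\tfrac12\phi_2+\tfrac18\pi,$$ where $\phi_2=\phi_2(a)=\arg\Gamma(\tfrac12+ia)$ is the branch that is continuous in $a\in\mathbb R$ and vanishes at $a=0$. For real $x$ the complementary Nield–Kuznetsov function is $$\hat N_W(a,x)=W(a,x)\int_x^\infty W(a,-t)\,dt-W(a,-x)\int_x^\infty W(a,t)\,dt,$$ with improper integrals $\int_x^\infty=\lim_{R\to\infty}\int_x^R$, and for $z\in\mathbb C$ put $$W_0^{(0,3)}(a,z)=ie^{\pi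 a/2}\left[W_3(a,z)\int_{e^{\pi i/4}\infty}^zW_0(a,t)\,dt-W_0(a,z)\int_{e^{-\pi i/4}\infty}^zW_3(a,t)\,dt\right],$$ where $\int_{e^{i\theta}\infty}^z=\lim_{R\to\infty}\int_{Re^{i\theta}}^z$. Theorem. All these improper integrals converge. The function $W(a,\cdot)$ is entire, and $\hat N_W(a,\cdot)$ has a unique extension from $\mathbb R$ to an entire function $\hat N_W(a,z)$; it is given by the defining formula of $\hat N_W$ with $x$ replaced by $z$, where $\int_z^\infty=-\int_{+\infty}^z$. For all $z\in\mathbb C$, $$\hat N_W(a,z)=W_0^{(0,3)}(a,z),$$ and this function satisfies $y''+(\tfrac14z^2-a)y=1$. Moreover $\hat N_W(a,x)\sim 4/x^2$ as $x\to+\infty$, and $-\hat N_W(a,x)$ is the unique solution $y:\mathbb R\to\mathbb C$ of $y''+(\tfrac14x^2-a)y=-1$ with $y(x)\sim-4/x^2$ as $x\to+\infty$. -/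

import Mathlib

open Filter Topology Asymptotics

noncomputable section

namespace NieldKuznetsov

/-- The parabolic cylinder function `U(α, z)` for `Re α > -1/2` and `z ∈ ℂ`:
`U(α, z) = e^{-z²/4} / Γ(1/2 + α) · ∫_0^∞ t^{α - 1/2} e^{-t²/2 - z t} dt`.
Below it is only used for purely imaginary `α`. -/
def parabolicU (α z : ℂ) : ℂ :=
  Complex.exp (-z ^ 2 / 4) / Complex.Gamma (1 / 2 + α) *
    ∫ t in Set.Ioi (0 : ℝ), (t : ℂ) ^ (α - 1 / 2) * Complex.exp (-(t : ℂ) ^ 2 / 2 - z * t)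

/-- `W_j(a, z) = U((-1)^j i a, (-i)^j z e^{-πi/4})`. -/
def weberWj (j : ℕ) (a : ℝ) (z : ℂ) : ℂ :=
  parabolicU ((-1) ^ j * Complex.I * a)
    ((-Complex.I) ^ j * z * Complex.exp (-(Real.pi * Complex.I / 4)))

/-- `k = √(1 + e^{2πa}) - e^{πa}`. -/
def weberK (a : ℝ) : ℝ :=
  Real.sqrt (1 + Real.exp (2 * Real.pi * a)) - Real.exp (Real.pi * a)

/-- `φ₂(a) = arg Γ(1/2 + i a)`, the branch that is continuous in `a` and vanishes at `a = 0`.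
It is written as the integral of its derivative `Re ψ(1/2 + i a)`, where `ψ = Γ'/Γ`; see
`weberPhi_zero`, `continuous_weberPhi` and `Gamma_eq_norm_mul_exp_weberPhi`. -/
def weberPhi (a : ℝ) : ℝ :=
  ∫ s in (0 : ℝ)..a, (Complex.digamma (1 / 2 + Complex.I * s)).re

/-- `ρ = φ₂/2 + π/8`. -/
def weberRho (a : ℝ) : ℝ := weberPhi a / 2 + Real.pi / 8

/-- The Weber function `W(a, z)` for real `a` and complex `z`:
`W(a, z) = √(k/2) e^{πa/4} (e^{iρ} W_0(a, z) + e^{-iρ} W_3(a, z))`. -/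
def weberW (a : ℝ) (z : ℂ) : ℂ :=
  (Real.sqrt (weberK a / 2) * Real.exp (Real.pi * a / 4) : ℝ) *
    (Complex.exp (Complex.I * weberRho a) * weberWj 0 a z +
      Complex.exp (-(Complex.I * weberRho a)) * weberWj 3 a z)

/-- The improper (possibly only conditionally convergent) integral `∫_x^∞ f(t) dt` converges. -/
def ImproperConverges (f : ℝ → ℂ) (x : ℝ) : Prop :=
  ∃ l : ℂ, Tendsto (fun R : ℝ => ∫ t in x..R, f t) atTop (𝓝 l)

/-- The improper integral `∫_x^∞ f(t) dt = lim_{R → ∞} ∫_x^R f(t) dt`. -/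
def improperIntegral (f : ℝ → ℂ) (x : ℝ) : ℂ :=
  limUnder atTop (fun R : ℝ => ∫ t in x..R, f t)

/-- The complementary Nield-Kuznetsov function for real `x`:
`N̂_W(a, x) = W(a, x) ∫_x^∞ W(a, -t) dt - W(a, -x) ∫_x^∞ W(a, t) dt`. -/
def nieldHat (a x : ℝ) : ℂ :=
  weberW a x * improperIntegral (fun t => weberW a (-t)) x -
    weberW a (-x) * improperIntegral (fun t => weberW a t) x

/-- The complex line integral `∫_p^q f(t) dt` along the straight segment from `p` to `q`. -/
def segmentIntegral (f : ℂ → ℂ) (p q : ℂ) : ℂ :=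
  (q - p) * ∫ s in (0 : ℝ)..1, f (p + s * (q - p))

/-- The contour integral `∫_{e^{iθ}∞}^z f(t) dt` converges. -/
def ContourConverges (f : ℂ → ℂ) (θ : ℝ) (z : ℂ) : Prop :=
  ∃ l : ℂ, Tendsto (fun R : ℝ => segmentIntegral f (R * Complex.exp (Complex.I * θ)) z)
    atTop (𝓝 l)

/-- The contour integral `∫_{e^{iθ}∞}^z f(t) dt = lim_{R → ∞} ∫_{R e^{iθ}}^z f(t) dt`, used for
entire functions `f`, for which the path from `R e^{iθ}` to `z` is immaterial. -/
def contourFromInfinity (f : ℂ → ℂ) (θ : ℝ) (z : ℂ) : ℂ :=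
  limUnder atTop (fun R : ℝ => segmentIntegral f (R * Complex.exp (Complex.I * θ)) z)

/-- The formula for `N̂_W` read at complex `z`, with `∫_z^∞ f(t) dt = -∫_{+∞}^z f(t) dt`. -/
def nieldHatC (a : ℝ) (z : ℂ) : ℂ :=
  weberW a z * (-contourFromInfinity (fun t => weberW a (-t)) 0 z) -
    weberW a (-z) * (-contourFromInfinity (fun t => weberW a t) 0 z)

/-- `W_R^{(0,3)}(a, z) = i e^{πa/2} (W_3(a, z) ∫_{e^{πi/4}∞}^z t^R W_0(a, t) dt
  - W_0(a, z) ∫_{e^{-πi/4}∞}^z t^R W_3(a, t) dt)`. -/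
def weberW03 (R : ℕ) (a : ℝ) (z : ℂ) : ℂ :=
  Complex.I * (Real.exp (Real.pi * a / 2) : ℝ) *
    (weberWj 3 a z * contourFromInfinity (fun t => t ^ R * weberWj 0 a t) (Real.pi / 4) z -
      weberWj 0 a z * contourFromInfinity (fun t => t ^ R * weberWj 3 a t) (-(Real.pi / 4)) z)

/-- `y` is a solution on the real line of `y'' + (x²/4 - a) y = -1`. -/
def SolvesInhomogeneousWeber (a : ℝ) (y : ℝ → ℂ) : Prop :=
  ∃ y' : ℝ → ℂ, ∀ x : ℝ, HasDerivAt y (y' x) x ∧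
    HasDerivAt y' (-1 - ((x : ℂ) ^ 2 / 4 - a) * y x) x

theorem weberPhi_zero : weberPhi 0 = 0 := by simp [weberPhi]

theorem half_add_ne (s : ℝ) (m : ℕ) : (1 / 2 + Complex.I * s : ℂ) ≠ -m := by
  intro h
  have := congrArg Complex.re h
  simp at this
  have h2 : (0 : ℝ) ≤ m := Nat.cast_nonneg m
  linarith

theorem continuous_digamma_line :
    Continuous fun s : ℝ => Complex.digamma (1 / 2 + Complex.I * s) := by
  have hopen : IsOpen {z : ℂ | 0 < z.re} := isOpen_lt continuous_const Complex.continuous_re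
  have hd : DifferentiableOn ℂ Complex.Gamma {z : ℂ | 0 < z.re} := fun z hz =>
    (Complex.differentiableAt_Gamma z (fun m h => by
      have h1 : 0 < z.re := hz
      rw [h] at h1
      simp at h1
      have h2 : (0 : ℝ) ≤ m := Nat.cast_nonneg m
      linarith)).differentiableWithinAt
  have hd' := (hd.deriv hopen).continuousOn
  have hline : Continuous fun s : ℝ => (1 / 2 + Complex.I * s : ℂ) := by fun_prop
  have hmem : ∀ s : ℝ, (1 / 2 + Complex.I * s : ℂ) ∈ {z : ℂ | 0 < z.re} := fun s => by simp
  have h1 := hd'.comp_continuous hline hmem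
  have h2 := hd.continuousOn.comp_continuous hline hmem
  simp only [Complex.digamma, logDeriv_apply]
  exact h1.div h2 fun s => Complex.Gamma_ne_zero (half_add_ne s)

theorem continuous_weberPhi : Continuous weberPhi :=
  intervalIntegral.continuous_primitive
    (fun _ _ => (Complex.continuous_re.comp continuous_digamma_line).intervalIntegrable _ _) 0

/-- `φ₂(a)` is an argument of `Γ(1/2 + i a)`. -/
theorem Gamma_eq_norm_mul_exp_weberPhi (a : ℝ) :
    Complex.Gamma (1 / 2 + Complex.I * a) =
      ‖Complex.Gamma (1 / 2 + Complex.I * a)‖ * Complex.exp (Complex.I * weberPhi a) := by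
  set D : ℝ → ℂ := fun s => Complex.digamma (1 / 2 + Complex.I * s) with hD
  have hDc : Continuous D := continuous_digamma_line
  set P : ℝ → ℂ := fun b => ∫ s in (0 : ℝ)..b, D s with hP
  have hPd : ∀ b, HasDerivAt P (D b) b := fun b =>
    intervalIntegral.integral_hasDerivAt_right (hDc.intervalIntegrable _ _)
      (hDc.stronglyMeasurableAtFilter _ _) hDc.continuousAt
  have hG : ∀ b : ℝ, HasDerivAt (fun s : ℝ => Complex.Gamma (1 / 2 + Complex.I * s))
      (Complex.I * D b * Complex.Gamma (1 / 2 + Complex.I * b)) b := by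
    intro b
    have h0 : HasDerivAt (fun z : ℂ => 1 / 2 + Complex.I * z) (Complex.I * 1) (b : ℂ) :=
      ((hasDerivAt_id (b : ℂ)).const_mul Complex.I).const_add _
    have h1 := (Complex.differentiableAt_Gamma _ (half_add_ne b)).hasDerivAt
    have h2 := (HasDerivAt.comp (b : ℂ) h1 h0).comp_ofReal
    refine h2.congr_deriv ?_
    have := Complex.Gamma_ne_zero (half_add_ne b)
    have h4 : D b * Complex.Gamma (1 / 2 + Complex.I * b) =
        deriv Complex.Gamma (1 / 2 + Complex.I * b) := by
      change logDeriv Complex.Gamma _ * _ = _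
      rw [logDeriv_apply]
      exact div_mul_cancel₀ _ this
    rw [mul_assoc, h4, mul_one, mul_comm]
  have hQ : ∀ b : ℝ, HasDerivAt
      (fun s : ℝ => Complex.Gamma (1 / 2 + Complex.I * s) * Complex.exp (-(Complex.I * P s)))
      0 b := by
    intro b
    have h5 := (hG b).mul (((hPd b).const_mul Complex.I).neg.cexp)
    refine h5.congr_deriv ?_
    simp only [Pi.neg_apply]
    ring
  have hconst := is_const_of_deriv_eq_zero (fun b => (hQ b).differentiableAt)
    (fun b => (hQ b).deriv) a 0
  have hP0 : P 0 = 0 := by simp [hP]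
  have hval : Complex.Gamma (1 / 2 + Complex.I * a) =
      (Real.sqrt Real.pi : ℝ) * Complex.exp (Complex.I * P a) := by
    have h3 : Complex.Gamma (1 / 2) = (Real.sqrt Real.pi : ℝ) := by
      rw [← Real.Gamma_one_half_eq, ← Complex.Gamma_ofReal]
      norm_num
    simp only [hP0, Complex.ofReal_zero, mul_zero, add_zero, neg_zero, Complex.exp_zero, mul_one,
      h3] at hconst
    rw [← hconst, mul_assoc, ← Complex.exp_add]
    simp
  have hre : (P a).re = weberPhi a := by
    simp only [hP, weberPhi]
    exact ((Complex.reCLM.intervalIntegral_comp_comm (hDc.intervalIntegrable 0 a))).symm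
  have hsplit : Complex.exp (Complex.I * P a) =
      (Real.exp (-(P a).im) : ℝ) * Complex.exp (Complex.I * weberPhi a) := by
    rw [Complex.ofReal_exp, ← Complex.exp_add, ← hre]
    congr 1
    apply Complex.ext <;> simp
  have hn : ‖Complex.exp (Complex.I * (weberPhi a : ℂ))‖ = 1 := by
    rw [mul_comm]; exact Complex.norm_exp_ofReal_mul_I _
  rw [hval, hsplit, norm_mul, norm_mul, hn, Complex.norm_real, Complex.norm_real,
    Real.norm_of_nonneg (Real.sqrt_nonneg _), Real.norm_of_nonneg (Real.exp_pos _).le]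
  push_cast
  ring

end NieldKuznetsov

end

/-!
Both `W_0(a, z) = U(ia, e^{-πi/4} z)` and `W_3(a, z) = U(-ia, e^{πi/4} z)` solve Weber's equation
`y'' = (a - z²/4) y`, and the theorem reduces to three facts about them.

* Connection formula (`weberW_neg`). `W(a, -z)` is
  `-i e^{πa/4} (e^{iρ} W_0 - e^{-iρ} W_3) / √(2k)`. Both sides solve Weber's equation, so it
  suffices to compare values and derivatives at `0`. These are Gamma quotients, and the reflection
  and duplication formulas show that `(e^{iρ} W_0(0))²` and `(e^{iρ} W_0'(0))²` are positive
  multiples of `(1 + ik)²` and `(1 - ik)²` (`exists_sq_initial_values`). Inserting the formula in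
  the definition of `N̂_W` leaves only the mixed products, which is `W_0^{(0,3)}`
  (`weberW_mul_sub_weberW_neg_mul`). The inhomogeneous equation follows by variation of constants
  from the Wronskian `W_0 W_3' - W_0' W_3 = -i e^{-πa/2}` (`weberWj_wronskian`).

* Asymptotics of primitives (`exists_primitive_asymptotics`). In the sector `|arg w| ≤ π/4` the
  function `U(α, w)` is bounded and `U'(α, w) = O(w)`, directly from the integral. With
  `P = 4/w² - 16α/w⁴` one has `(P U' - P' U)' = U + O(w⁻⁴)`, so every primitive of `U` is
  `L + P U' - P' U + O(w⁻³)` in the whole sector. The sector contains the images of the positive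
  real axis and of the ray of angle `±π/4` under the two rotations; this gives the convergence of
  all improper integrals and the independence of the direction. In `N̂_W` the terms with `P'`
  cancel, and those with `P` combine to the Wronskian, whence `N̂_W = 4/x² + O(x⁻³)`
  (`isEquivalent_nieldOfPrimitives`).

* Uniqueness (`eq_zero_of_isLittleO`). If a solution `f` of Weber's equation is `o(x⁻²)`, then `f`
  and `f''` tend to `0`, hence so does `f'`; its constant Wronskians with `W_0` and `W_3` then
  tend to `0`, and `f = 0`.
-/

noncomputable section

namespace NieldKuznetsov

/-! ### The integral `∫_0^∞ t^{s-1} e^{-t²/2 - wt} dt` -/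

/-- The integrand `t^{s-1} e^{-t²/2 - wt}` of the integral representation of `U`. -/
def gaussKernel (s w : ℂ) (t : ℝ) : ℂ :=
  (t : ℂ) ^ (s - 1) * Complex.exp (-(t : ℂ) ^ 2 / 2 - w * t)

/-- The Mellin transform at `s` of `t ↦ e^{-t²/2 - wt}`; up to elementary factors it is
`U(s - 1/2, w)`. -/
def gaussMellin (s w : ℂ) : ℂ := ∫ t in Set.Ioi (0 : ℝ), gaussKernel s w t

theorem norm_gaussKernel (s w : ℂ) {t : ℝ} (ht : 0 < t) :
    ‖gaussKernel s w t‖ = t ^ (s.re - 1) * Real.exp (-t ^ 2 / 2 - w.re * t) := by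
  rw [gaussKernel, norm_mul, Complex.norm_cpow_eq_rpow_re_of_pos ht, Complex.norm_exp]
  congr 2
  have : (-(t : ℂ) ^ 2 / 2 - w * t) = ((-t ^ 2 / 2 : ℝ) : ℂ) - w * t := by push_cast; ring
  rw [this, Complex.sub_re, Complex.ofReal_re, Complex.re_mul_ofReal]

theorem norm_gaussKernel_le (s : ℂ) {w : ℂ} {M t : ℝ} (hw : |w.re| ≤ M) (ht : 0 < t) :
    ‖gaussKernel s w t‖ ≤ Real.exp (M ^ 2) * (t ^ (s.re - 1) * Real.exp (-(1 / 4) * t ^ 2)) := by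
  rw [norm_gaussKernel s w ht, mul_left_comm, ← Real.exp_add]
  gcongr
  have := (abs_le.mp hw).1
  nlinarith [sq_nonneg (t / 2 - M), mul_le_mul_of_nonneg_right this ht.le]

theorem continuousOn_gaussKernel (s w : ℂ) :
    ContinuousOn (gaussKernel s w) (Set.Ioi 0) := by
  intro t ht
  have h1 : ContinuousAt (fun t : ℝ => (t : ℂ) ^ (s - 1)) t :=
    Complex.continuousAt_ofReal_cpow_const t _ (Or.inr (ne_of_gt ht))
  have h2 : ContinuousAt (fun t : ℝ => Complex.exp (-(t : ℂ) ^ 2 / 2 - w * t)) t := by fun_prop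
  exact (h1.mul h2).continuousWithinAt

theorem aestronglyMeasurable_gaussKernel (s w : ℂ) :
    MeasureTheory.AEStronglyMeasurable (gaussKernel s w)
      (MeasureTheory.volume.restrict (Set.Ioi 0)) :=
  (continuousOn_gaussKernel s w).aestronglyMeasurable measurableSet_Ioi

theorem integrableOn_gaussBound {σ : ℝ} (hs : 0 < σ) (K : ℝ) :
    MeasureTheory.IntegrableOn
      (fun t : ℝ => K * (t ^ (σ - 1) * Real.exp (-(1 / 4) * t ^ 2))) (Set.Ioi 0) :=
  (integrableOn_rpow_mul_exp_neg_mul_sq (by norm_num) (by linarith)).const_mul K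

theorem integrableOn_gaussKernel {s : ℂ} (hs : 0 < s.re) (w : ℂ) :
    MeasureTheory.IntegrableOn (gaussKernel s w) (Set.Ioi 0) := by
  refine (integrableOn_gaussBound hs (Real.exp (|w.re| ^ 2))).mono'
    (aestronglyMeasurable_gaussKernel s w) ?_
  exact (MeasureTheory.ae_restrict_mem measurableSet_Ioi).mono
    fun t ht => norm_gaussKernel_le s le_rfl ht

theorem gaussKernel_add_one (s w : ℂ) {t : ℝ} (ht : 0 < t) :
    gaussKernel (s + 1) w t = t * gaussKernel s w t := by
  have h : (t : ℂ) ≠ 0 := by exact_mod_cast ht.ne'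
  rw [gaussKernel, gaussKernel, show s + 1 - 1 = (s - 1) + 1 by ring, Complex.cpow_add _ _ h,
    Complex.cpow_one]
  ring

theorem hasDerivAt_gaussMellin {s : ℂ} (hs : 0 < s.re) (w : ℂ) :
    HasDerivAt (gaussMellin s) (-gaussMellin (s + 1) w) w := by
  have hs1 : 0 < (s + 1).re := by simp; linarith
  have key := (hasDerivAt_integral_of_dominated_loc_of_deriv_le
    (μ := MeasureTheory.volume.restrict (Set.Ioi (0 : ℝ))) (x₀ := w)
    (F := fun w t => gaussKernel s w t) (F' := fun w t => -gaussKernel (s + 1) w t)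
    (bound := fun t => Real.exp ((|w.re| + 1) ^ 2) *
      (t ^ ((s + 1).re - 1) * Real.exp (-(1 / 4) * t ^ 2)))
    (Metric.ball_mem_nhds w one_pos)
    (Eventually.of_forall fun v => aestronglyMeasurable_gaussKernel s v)
    (integrableOn_gaussKernel hs w) (aestronglyMeasurable_gaussKernel (s + 1) w).neg ?_
    (integrableOn_gaussBound hs1 _) ?_).2
  · rw [MeasureTheory.integral_neg] at key
    exact key
  · refine (MeasureTheory.ae_restrict_mem measurableSet_Ioi).mono fun t ht v hv => ?_
    rw [norm_neg]
    refine norm_gaussKernel_le _ ?_ ht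
    have h1 : |(v - w).re| ≤ ‖v - w‖ := Complex.abs_re_le_norm _
    have h2 : ‖v - w‖ < 1 := by simpa [dist_eq_norm] using hv
    have h3 : |v.re| ≤ |(v - w).re| + |w.re| := by
      have := abs_add_le (v - w).re w.re
      simpa using this
    linarith
  · refine (MeasureTheory.ae_restrict_mem measurableSet_Ioi).mono fun t ht v _ => ?_
    rw [gaussKernel_add_one s v ht]
    have h1 : HasDerivAt (fun v : ℂ => -(t : ℂ) ^ 2 / 2 - v * t) (-(1 * (t : ℂ))) v :=
      ((hasDerivAt_id v).mul_const (t : ℂ)).const_sub (-(t : ℂ) ^ 2 / 2)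
    refine (h1.cexp.const_mul ((t : ℂ) ^ (s - 1))).congr_deriv ?_
    rw [gaussKernel]
    ring

/-- Integration by parts of `d/dt (t^s e^{-t²/2 - wt})`. -/
theorem gaussMellin_recurrence {s : ℂ} (hs : 0 < s.re) (w : ℂ) :
    gaussMellin (s + 2) w + w * gaussMellin (s + 1) w = s * gaussMellin s w := by
  have hs1 : 0 < (s + 1).re := by simp; linarith
  have hs2 : 0 < (s + 1 + 1).re := by simp; linarith
  have i0 := (integrableOn_gaussKernel hs w).const_mul s
  have i1 := (integrableOn_gaussKernel hs1 w).const_mul w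
  have i2 := integrableOn_gaussKernel hs2 w
  have i01 : MeasureTheory.IntegrableOn (fun t : ℝ => s * gaussKernel s w t
      - w * gaussKernel (s + 1) w t) (Set.Ioi 0) := i0.sub i1
  have hderiv : ∀ t ∈ Set.Ioi (0 : ℝ), HasDerivAt (fun t : ℝ => gaussKernel (s + 1) w t)
      (s * gaussKernel s w t - w * gaussKernel (s + 1) w t - gaussKernel (s + 1 + 1) w t) t := by
    intro t ht
    have ht' : (t : ℂ) ≠ 0 := by exact_mod_cast (ne_of_gt ht)
    have hs0 : s ≠ 0 := fun h => by simp [h] at hs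
    have h1 : HasDerivAt (fun x : ℂ => x ^ s) (s * (t : ℂ) ^ (s - 1) * 1) (t : ℂ) :=
      (hasDerivAt_id (t : ℂ)).cpow_const (Or.inl (by simpa using ht))
    have h2 : HasDerivAt (fun x : ℂ => -x ^ 2 / 2 - w * x)
        (-((2 : ℕ) * (t : ℂ) ^ (2 - 1) * 1) / 2 - w * 1) (t : ℂ) :=
      (((hasDerivAt_id (t : ℂ)).pow 2).neg.div_const 2).sub ((hasDerivAt_id (t : ℂ)).const_mul w)
    have h3 := (h1.mul h2.cexp).comp_ofReal
    rw [gaussKernel_add_one (s + 1) w ht, gaussKernel_add_one s w ht]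
    refine (h3.congr_deriv ?_).congr_of_eventuallyEq ?_
    · have e : (t : ℂ) ^ s = t * (t : ℂ) ^ (s - 1) := by
        rw [Complex.cpow_sub _ _ ht', Complex.cpow_one]
        field_simp
      rw [e]
      simp only [gaussKernel]
      push_cast
      ring
    · filter_upwards with x
      simp [gaussKernel]
  have hi : MeasureTheory.IntegrableOn (fun t : ℝ => s * gaussKernel s w t
      - w * gaussKernel (s + 1) w t - gaussKernel (s + 1 + 1) w t) (Set.Ioi 0) :=
    i01.sub i2
  have hcont : ContinuousWithinAt (fun t : ℝ => gaussKernel (s + 1) w t) (Set.Ici 0) 0 := by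
    have h1 : Continuous (fun t : ℝ => (t : ℂ) ^ (s + 1 - 1)) :=
      Complex.continuous_ofReal_cpow_const (by simpa using hs)
    have h2 : Continuous (fun t : ℝ => Complex.exp (-(t : ℂ) ^ 2 / 2 - w * t)) := by fun_prop
    exact (h1.mul h2).continuousWithinAt
  have hlim := MeasureTheory.tendsto_zero_of_hasDerivAt_of_integrableOn_Ioi hderiv hi
    (integrableOn_gaussKernel hs1 w)
  have h := MeasureTheory.integral_Ioi_of_hasDerivAt_of_tendsto hcont hderiv hi hlim
  have hs0 : s ≠ 0 := fun h => by simp [h] at hs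
  have hzero : gaussKernel (s + 1) w 0 = 0 := by
    simp [gaussKernel, hs0]
  rw [hzero, sub_zero, MeasureTheory.integral_sub i01 i2,
    MeasureTheory.integral_sub i0 i1, MeasureTheory.integral_const_mul,
    MeasureTheory.integral_const_mul] at h
  rw [show s + 2 = s + 1 + 1 by ring]
  change s * gaussMellin s w - w * gaussMellin (s + 1) w - gaussMellin (s + 1 + 1) w = 0 at h
  linear_combination -h

theorem norm_gaussMellin_le {s w : ℂ} (hs : 0 < s.re) (hw : 0 ≤ w.re) :
    ‖gaussMellin s w‖ ≤
      ∫ t in Set.Ioi (0 : ℝ), 1 * (t ^ (s.re - 1) * Real.exp (-(1 / 4) * t ^ 2)) := by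
  refine MeasureTheory.norm_integral_le_of_norm_le (integrableOn_gaussBound hs 1) ?_
  refine (MeasureTheory.ae_restrict_mem measurableSet_Ioi).mono fun t ht => ?_
  have ht : 0 < t := ht
  rw [norm_gaussKernel s w ht, one_mul]
  gcongr
  nlinarith [mul_nonneg hw ht.le]

theorem gaussMellin_zero {s : ℂ} (hs : 0 < s.re) :
    gaussMellin s 0 = 2 ^ (s / 2 - 1) * Complex.Gamma (s / 2) := by
  have h1 := mellin_comp_rpow (fun u : ℝ => Complex.exp (-(((1 / 2 : ℝ) : ℂ) * u))) s 2
  have h2 : mellin (fun u : ℝ => Complex.exp (-(((1 / 2 : ℝ) : ℂ) * u))) (s / (2 : ℝ)) =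
      (1 / ((1 / 2 : ℝ) : ℂ)) ^ (s / 2) * Complex.Gamma (s / 2) := by
    rw [← Complex.integral_cpow_mul_exp_neg_mul_Ioi (by simpa using hs) (by norm_num)]
    simp [mellin]
  have h3 : gaussMellin s 0 =
      mellin (fun t : ℝ => Complex.exp (-(((1 / 2 : ℝ) : ℂ) * (t ^ (2 : ℝ) : ℝ)))) s := by
    rw [mellin, gaussMellin]
    congr 1
    ext t
    rw [gaussKernel, smul_eq_mul]
    congr 2
    push_cast
    rw [Real.rpow_two]
    push_cast
    ring
  rw [h3, h1, h2, Complex.cpow_sub _ _ two_ne_zero, Complex.cpow_one, Complex.real_smul]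
  norm_num
  ring

/-! ### The parabolic cylinder function and its differential equation -/

theorem parabolicU_eq (α z : ℂ) :
    parabolicU α z =
      Complex.exp (-z ^ 2 / 4) / Complex.Gamma (1 / 2 + α) * gaussMellin (α + 1 / 2) z := by
  rw [parabolicU, gaussMellin]
  simp only [gaussKernel, show α + 1 / 2 - 1 = α - 1 / 2 by ring]

/-- The derivative of `U(α, ·)`. -/
def parabolicUDeriv (α z : ℂ) : ℂ :=
  Complex.exp (-z ^ 2 / 4) / Complex.Gamma (1 / 2 + α) *
    (-(z / 2) * gaussMellin (α + 1 / 2) z - gaussMellin (α + 1 / 2 + 1) z)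

theorem hasDerivAt_exp_neg_sq_div (z : ℂ) :
    HasDerivAt (fun z : ℂ => Complex.exp (-z ^ 2 / 4))
      (Complex.exp (-z ^ 2 / 4) * -(z / 2)) z := by
  have h := (((hasDerivAt_id z).pow 2).neg.div_const 4).cexp
  refine h.congr_deriv ?_
  simp
  ring

theorem hasDerivAt_parabolicU {α : ℂ} (hα : -(1 / 2) < α.re) (z : ℂ) :
    HasDerivAt (parabolicU α) (parabolicUDeriv α z) z := by
  have hs : 0 < (α + 1 / 2).re := by simp; linarith
  have h := ((hasDerivAt_exp_neg_sq_div z).div_const (Complex.Gamma (1 / 2 + α))).mul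
    (hasDerivAt_gaussMellin hs z)
  rw [show parabolicU α = _ from funext (parabolicU_eq α)]
  refine h.congr_deriv ?_
  rw [parabolicUDeriv]
  ring

theorem hasDerivAt_parabolicUDeriv {α : ℂ} (hα : -(1 / 2) < α.re) (z : ℂ) :
    HasDerivAt (parabolicUDeriv α) ((z ^ 2 / 4 + α) * parabolicU α z) z := by
  have hs : 0 < (α + 1 / 2).re := by simp; linarith
  have hs1 : 0 < (α + 1 / 2 + 1).re := by simp; linarith
  have hlin : HasDerivAt (fun z : ℂ => -(z / 2)) (-(1 / 2)) z :=
    ((hasDerivAt_id z).div_const 2).neg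
  have h := ((hasDerivAt_exp_neg_sq_div z).div_const (Complex.Gamma (1 / 2 + α))).mul
    ((hlin.mul (hasDerivAt_gaussMellin hs z)).sub (hasDerivAt_gaussMellin hs1 z))
  refine h.congr_deriv ?_
  have hrec := gaussMellin_recurrence hs z
  rw [show α + 1 / 2 + 2 = α + 1 / 2 + 1 + 1 by ring] at hrec
  simp only [Pi.mul_apply, Pi.sub_apply]
  rw [parabolicU_eq]
  linear_combination (Complex.exp (-z ^ 2 / 4) / Complex.Gamma (1 / 2 + α)) * hrec

theorem parabolicU_zero {α : ℂ} (hα : -(1 / 2) < α.re) :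
    parabolicU α 0 = 2 ^ (α / 2 - 3 / 4) * Complex.Gamma (α / 2 + 1 / 4) /
      Complex.Gamma (1 / 2 + α) := by
  have hs : 0 < (α + 1 / 2).re := by simp; linarith
  rw [parabolicU_eq, gaussMellin_zero hs, show (α + 1 / 2) / 2 - 1 = α / 2 - 3 / 4 by ring,
    show (α + 1 / 2) / 2 = α / 2 + 1 / 4 by ring]
  simp
  ring

theorem parabolicUDeriv_zero {α : ℂ} (hα : -(1 / 2) < α.re) :
    parabolicUDeriv α 0 = -(2 ^ (α / 2 - 1 / 4) * Complex.Gamma (α / 2 + 3 / 4) /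
      Complex.Gamma (1 / 2 + α)) := by
  have hs : 0 < (α + 1 / 2 + 1).re := by simp; linarith
  rw [parabolicUDeriv, gaussMellin_zero hs,
    show (α + 1 / 2 + 1) / 2 - 1 = α / 2 - 1 / 4 by ring,
    show (α + 1 / 2 + 1) / 2 = α / 2 + 3 / 4 by ring]
  simp
  ring

/-! ### Behaviour in the sector `|arg w| ≤ π/4` -/

/-- The closed sector `|arg w| ≤ π/4`, in which `e^{-w²/4}` is bounded. -/
def quarterSector : Set ℂ := {w | |w.im| ≤ w.re}

theorem convex_quarterSector_inter (r : ℝ) :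
    Convex ℝ (quarterSector ∩ {w | r ≤ w.re}) := by
  intro x hx y hy b c hb hc hbc
  obtain ⟨hx1, hx2⟩ := hx
  obtain ⟨hy1, hy2⟩ := hy
  simp only [quarterSector, Set.mem_ofPred_eq] at hx1 hx2 hy1 hy2
  constructor
  · simp only [quarterSector, Set.mem_ofPred_eq, Complex.add_im, Complex.add_re,
      Complex.real_smul, Complex.re_ofReal_mul, Complex.im_ofReal_mul]
    rw [abs_le] at *
    constructor <;> nlinarith
  · simp only [Set.mem_ofPred_eq, Complex.add_re, Complex.real_smul, Complex.re_ofReal_mul]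
    have h1 : b * r + c * r = r := by rw [← add_mul, hbc, one_mul]
    linarith [mul_le_mul_of_nonneg_left hx2 hb, mul_le_mul_of_nonneg_left hy2 hc]

theorem norm_le_of_mem_quarterSector {w : ℂ} (hw : w ∈ quarterSector) : ‖w‖ ≤ 2 * w.re := by
  have h1 := Complex.norm_le_abs_re_add_abs_im w
  have h2 : |w.im| ≤ w.re := hw
  have h3 : 0 ≤ w.re := (abs_nonneg _).trans h2
  rw [abs_of_nonneg h3] at h1
  linarith

theorem norm_exp_neg_sq_le_one {w : ℂ} (hw : w ∈ quarterSector) :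
    ‖Complex.exp (-w ^ 2 / 4)‖ ≤ 1 := by
  rw [Complex.norm_exp, Real.exp_le_one_iff]
  have h2 : |w.im| ≤ w.re := hw
  have h3 : w.im ^ 2 ≤ w.re ^ 2 := by
    rw [← sq_abs w.im]
    exact pow_le_pow_left₀ (abs_nonneg _) h2 2
  have h4 : (-w ^ 2 / 4).re = -(w.re ^ 2 - w.im ^ 2) / 4 := by
    rw [show (4 : ℂ) = ((4 : ℝ) : ℂ) by norm_num, Complex.div_ofReal_re]
    simp [pow_two]
  rw [h4]
  linarith

theorem exists_bound_parabolicU {α : ℂ} (hα : -(1 / 2) < α.re) :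
    ∃ C : ℝ, ∀ w ∈ quarterSector,
      ‖parabolicU α w‖ ≤ C ∧ ‖parabolicUDeriv α w‖ ≤ C * (1 + ‖w‖) := by
  have hs : 0 < (α + 1 / 2).re := by simp; linarith
  have hs1 : 0 < (α + 1 / 2 + 1).re := by simp; linarith
  set B := ∫ t in Set.Ioi (0 : ℝ), 1 * (t ^ ((α + 1 / 2).re - 1) * Real.exp (-(1 / 4) * t ^ 2))
  set B' := ∫ t in Set.Ioi (0 : ℝ),
    1 * (t ^ ((α + 1 / 2 + 1).re - 1) * Real.exp (-(1 / 4) * t ^ 2))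
  set G := ‖Complex.Gamma (1 / 2 + α)‖⁻¹
  have hG : 0 ≤ G := by positivity
  have hpre : ∀ w ∈ quarterSector,
      ‖Complex.exp (-w ^ 2 / 4) / Complex.Gamma (1 / 2 + α)‖ ≤ G := fun w hw => by
    rw [norm_div, div_eq_mul_inv]
    exact mul_le_of_le_one_left hG (norm_exp_neg_sq_le_one hw)
  refine ⟨G * (B + B'), fun w hw => ?_⟩
  have hre : 0 ≤ w.re := (abs_nonneg _).trans (show |w.im| ≤ w.re from hw)
  have b0 : ‖gaussMellin (α + 1 / 2) w‖ ≤ B := norm_gaussMellin_le hs hre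
  have b1 : ‖gaussMellin (α + 1 / 2 + 1) w‖ ≤ B' := norm_gaussMellin_le hs1 hre
  have hB : 0 ≤ B := (norm_nonneg _).trans b0
  have hB' : 0 ≤ B' := (norm_nonneg _).trans b1
  constructor
  · rw [parabolicU_eq, norm_mul]
    exact mul_le_mul (hpre w hw) (b0.trans (by linarith)) (norm_nonneg _) hG
  · rw [parabolicUDeriv, norm_mul, mul_assoc]
    refine mul_le_mul (hpre w hw) ?_ (norm_nonneg _) hG
    refine (norm_sub_le _ _).trans ?_
    rw [norm_mul, norm_neg, norm_div, Complex.norm_ofNat]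
    have hw0 := norm_nonneg w
    nlinarith [mul_le_mul_of_nonneg_left b0 (div_nonneg hw0 zero_le_two), mul_nonneg hB hw0,
      mul_nonneg hB' hw0]

/-- A function on `[1, ∞)` with derivative `O(t⁻⁴)` tends to a limit with error `O(t⁻³)`. -/
theorem exists_limit_of_deriv_le {f f' : ℝ → ℂ} {M : ℝ} (hf : ∀ t, 1 ≤ t → HasDerivAt f (f' t) t)
    (hM : ∀ t, 1 ≤ t → ‖f' t‖ ≤ M / t ^ 4) :
    ∃ L : ℂ, ∀ r, 1 ≤ r → ‖f r - L‖ ≤ M / r ^ 3 := by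
  have hM0 : 0 ≤ M := by simpa using (norm_nonneg _).trans (hM 1 le_rfl)
  have key : ∀ r R : ℝ, 1 ≤ r → r ≤ R → ‖f R - f r‖ ≤ M / r ^ 3 := by
    intro r R hr hrR
    have hr0 : 0 < r := by linarith
    have hR0 : 0 < R := by linarith
    have hB : ∀ x ∈ Set.Icc r R, HasDerivAt (fun t : ℝ => M / 3 * (1 / r ^ 3 - (t ^ 3)⁻¹))
        (M / x ^ 4) x := by
      intro x hx
      have hx0 : x ≠ 0 := by have := hx.1; linarith
      have h1 := (((hasDerivAt_pow 3 x).fun_inv (pow_ne_zero 3 hx0)).const_sub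
        (1 / r ^ 3)).const_mul (M / 3)
      refine h1.congr_deriv ?_
      field_simp
      push_cast
      ring
    have h := image_norm_le_of_norm_deriv_right_le_deriv_boundary'
      (f := fun t => f t - f r) (f' := f') (a := r) (b := R)
      (fun x hx => ((hf x (hr.trans hx.1)).sub_const _).continuousAt.continuousWithinAt)
      (fun x hx => ((hf x (hr.trans hx.1)).sub_const _).hasDerivWithinAt)
      (B := fun t : ℝ => M / 3 * (1 / r ^ 3 - (t ^ 3)⁻¹)) (B' := fun x => M / x ^ 4) (by simp)
      (fun x hx => (hB x hx).continuousAt.continuousWithinAt)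
      (fun x hx => (hB x ⟨hx.1, hx.2.le⟩).hasDerivWithinAt)
      (fun x hx => hM x (hr.trans hx.1)) (Set.right_mem_Icc.mpr hrR)
    refine h.trans ?_
    have hR : 0 < (R ^ 3)⁻¹ := by positivity
    have hr3 : 0 < 1 / r ^ 3 := by positivity
    have : M / r ^ 3 = M * (1 / r ^ 3) := by ring
    rw [this]
    nlinarith [mul_nonneg hM0 hR.le, mul_nonneg hM0 hr3.le]
  have hlim : Tendsto (fun r : ℝ => M / (max 1 r) ^ 3) atTop (𝓝 0) := by
    refine Tendsto.div_atTop tendsto_const_nhds ?_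
    exact (tendsto_pow_atTop (by norm_num)).comp (tendsto_atTop_mono (le_max_right 1) tendsto_id)
  have hc : CauchySeq fun r : ℝ => f (max 1 r) := by
    refine cauchySeq_of_le_tendsto_0' (fun r : ℝ => M / (max 1 r) ^ 3) (fun r R hrR => ?_) hlim
    rw [dist_comm, dist_eq_norm]
    exact key _ _ (le_max_left _ _) (max_le_max le_rfl hrR)
  obtain ⟨L, hL⟩ := cauchySeq_tendsto_of_complete hc
  refine ⟨L, fun r hr => ?_⟩
  rw [norm_sub_rev]
  refine le_of_tendsto (hL.sub_const (f r)).norm ?_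
  filter_upwards [eventually_ge_atTop r] with R hR
  rw [max_eq_right (hr.trans hR)]
  exact key r R hr hR

/-- The truncated asymptotic series `4/w² - 16α/w⁴` of the solution of `y'' - (w²/4 + α) y = -1`,
chosen such that `P (w²/4 + α) - P'' = 1 + O(w⁻⁴)`. -/
def seriesP (α w : ℂ) : ℂ := 4 / w ^ 2 - 16 * α / w ^ 4

/-- The derivative of `seriesP α`. -/
def seriesPDeriv (α w : ℂ) : ℂ := -8 / w ^ 3 + 64 * α / w ^ 5

theorem hasDerivAt_seriesP (α : ℂ) {w : ℂ} (hw : w ≠ 0) :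
    HasDerivAt (seriesP α) (seriesPDeriv α w) w := by
  have h2 := ((hasDerivAt_pow 2 w).fun_inv (pow_ne_zero 2 hw)).const_mul 4
  have h4 := ((hasDerivAt_pow 4 w).fun_inv (pow_ne_zero 4 hw)).const_mul (16 * α)
  refine ((h2.sub h4).congr_deriv ?_).congr_of_eventuallyEq (Eventually.of_forall fun x => ?_)
  · rw [seriesPDeriv]
    field_simp
    push_cast
    ring
  · simp only [seriesP, Pi.sub_apply, div_eq_mul_inv]

theorem hasDerivAt_seriesPDeriv (α : ℂ) {w : ℂ} (hw : w ≠ 0) :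
    HasDerivAt (seriesPDeriv α) (24 / w ^ 4 - 320 * α / w ^ 6) w := by
  have h2 := ((hasDerivAt_pow 3 w).fun_inv (pow_ne_zero 3 hw)).const_mul (-8)
  have h4 := ((hasDerivAt_pow 5 w).fun_inv (pow_ne_zero 5 hw)).const_mul (64 * α)
  refine ((h2.add h4).congr_deriv ?_).congr_of_eventuallyEq (Eventually.of_forall fun x => ?_)
  · field_simp
    push_cast
    ring
  · simp only [seriesPDeriv, Pi.add_apply, div_eq_mul_inv]

theorem norm_div_pow_le (c : ℂ) {w : ℂ} {r : ℝ} (hr : 0 < r) (hw : r ≤ ‖w‖) (n : ℕ) :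
    ‖c / w ^ n‖ ≤ ‖c‖ / r ^ n := by
  rw [norm_div, norm_pow]
  gcongr

/-- In the sector `|arg w| ≤ π/4`, a primitive `g` of `U(α, ·)` tends to a limit `L` at infinity.
Since `(P U' - P' U)' = (P (w²/4 + α) - P'') U = U + O(w⁻⁴)`, the difference of `g` and
`P U' - P' U` converges with error `O(w⁻³)`. -/
theorem exists_primitive_asymptotics {α : ℂ} (hα : -(1 / 2) < α.re) {g : ℂ → ℂ}
    (hg : ∀ w, HasDerivAt g (parabolicU α w) w) :
    ∃ (L : ℂ) (K : ℝ), ∀ w ∈ quarterSector, 1 ≤ w.re →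
      ‖g w - L‖ ≤ K / w.re ∧
      ‖g w - (seriesP α w * parabolicUDeriv α w - seriesPDeriv α w * parabolicU α w) - L‖ ≤
        K / w.re ^ 3 := by
  obtain ⟨C, hC⟩ := exists_bound_parabolicU hα
  have hC0 : 0 ≤ C := (norm_nonneg _).trans (hC 0 (by simp [quarterSector])).1
  set H : ℂ → ℂ := fun w =>
    seriesP α w * parabolicUDeriv α w - seriesPDeriv α w * parabolicU α w with hH
  set E : ℂ → ℂ := fun w => (16 * α ^ 2 + 24) / w ^ 4 - 320 * α / w ^ 6 with hE
  set e : ℝ := ‖16 * α ^ 2 + 24‖ + ‖320 * α‖ with he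
  have hD : ∀ w : ℂ, w ≠ 0 → HasDerivAt (fun w => g w - H w) (E w * parabolicU α w) w := by
    intro w hw
    have h := (hg w).sub (((hasDerivAt_seriesP α hw).mul (hasDerivAt_parabolicUDeriv hα w)).sub
      ((hasDerivAt_seriesPDeriv α hw).mul (hasDerivAt_parabolicU hα w)))
    refine h.congr_deriv ?_
    simp only [hE, seriesP]
    field_simp
    ring
  have hDb : ∀ (w : ℂ) (r : ℝ), w ∈ quarterSector → 1 ≤ r → r ≤ w.re →
      ‖E w * parabolicU α w‖ ≤ e * C / r ^ 4 := by
    intro w r hw hr hrw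
    have hrw' : r ≤ ‖w‖ := hrw.trans (Complex.re_le_norm w)
    have hr0 : 0 < r := by linarith
    have h1 : ‖E w‖ ≤ e / r ^ 4 := by
      refine (norm_sub_le _ _).trans ?_
      rw [he, add_div ‖_‖ ‖_‖]
      refine add_le_add (norm_div_pow_le _ hr0 hrw' 4) ((norm_div_pow_le _ hr0 hrw' 6).trans ?_)
      gcongr
      norm_num
    rw [norm_mul, mul_div_right_comm]
    exact mul_le_mul h1 (hC w hw).1 (norm_nonneg _) (by positivity)
  have hreal : ∀ t : ℝ, 0 ≤ t → (t : ℂ) ∈ quarterSector := fun t ht => by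
    simpa [quarterSector] using ht
  -- the limit `L` is found on the positive real axis
  obtain ⟨L, hL⟩ := exists_limit_of_deriv_le (f := fun t : ℝ => g t - H t)
    (f' := fun t : ℝ => E t * parabolicU α t) (M := e * C)
    (fun t ht => (hD t (by exact_mod_cast (by linarith : t ≠ 0))).comp_ofReal)
    (fun t ht => hDb t t (hreal t (by linarith)) ht (by simp))
  have hrem : ∀ w ∈ quarterSector, 1 ≤ w.re → ‖g w - H w - L‖ ≤ 2 * (e * C) / w.re ^ 3 := by
    intro w hw hr
    have hr0 : 0 < w.re := by linarith
    -- the vertical segment from `w` to its real part stays in the sector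
    have h1 := Convex.norm_image_sub_le_of_norm_hasDerivWithin_le
      (f := fun w => g w - H w) (f' := fun w => E w * parabolicU α w)
      (C := e * C / w.re ^ 4) (s := quarterSector ∩ {v | w.re ≤ v.re})
      (fun v hv => (hD v (fun h0 => by
        have h := hv.2
        simp only [h0, Set.mem_ofPred_eq, Complex.zero_re] at h
        linarith)).hasDerivWithinAt)
      (fun v hv => hDb v w.re hv.1 hr hv.2) (convex_quarterSector_inter w.re)
      (x := (w.re : ℂ)) (y := w) ⟨hreal _ hr0.le, by simp⟩ ⟨hw, le_rfl (a := w.re)⟩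
    have h2 : ‖w - (w.re : ℂ)‖ ≤ w.re := by
      have : w - (w.re : ℂ) = w.im * Complex.I := by
        nth_rewrite 1 [← Complex.re_add_im w]
        ring
      rw [this, norm_mul, Complex.norm_I, mul_one, Complex.norm_real]
      exact hw
    have h3 := hL w.re hr
    have h4 : e * C / w.re ^ 4 * ‖w - (w.re : ℂ)‖ ≤ e * C / w.re ^ 3 := by
      calc e * C / w.re ^ 4 * ‖w - (w.re : ℂ)‖ ≤ e * C / w.re ^ 4 * w.re := by gcongr
        _ = e * C / w.re ^ 3 := by field_simp
    calc ‖g w - H w - L‖ = ‖((g w - H w) - (g w.re - H w.re)) + ((g w.re - H w.re) - L)‖ := by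
          ring_nf
      _ ≤ e * C / w.re ^ 3 + e * C / w.re ^ 3 := (norm_add_le _ _).trans
          (add_le_add (h1.trans h4) h3)
      _ = _ := by ring
  set K₁ : ℝ := (‖(4 : ℂ)‖ + ‖16 * α‖) * (3 * C) + (‖(-8 : ℂ)‖ + ‖64 * α‖) * C with hK₁
  have hHb : ∀ w ∈ quarterSector, 1 ≤ w.re → ‖H w‖ ≤ K₁ / w.re := by
    intro w hw hr
    have hr0 : 0 < w.re := by linarith
    have hrw : w.re ≤ ‖w‖ := Complex.re_le_norm w
    have h1 : ‖seriesP α w‖ ≤ (‖(4 : ℂ)‖ + ‖16 * α‖) / w.re ^ 2 := by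
      refine (norm_sub_le _ _).trans ?_
      rw [add_div]
      refine add_le_add (norm_div_pow_le _ hr0 hrw 2) ((norm_div_pow_le _ hr0 hrw 4).trans ?_)
      gcongr
      norm_num
    have h2 : ‖seriesPDeriv α w‖ ≤ (‖(-8 : ℂ)‖ + ‖64 * α‖) / w.re := by
      refine (norm_add_le _ _).trans ?_
      rw [add_div]
      refine add_le_add ((norm_div_pow_le _ hr0 hrw 3).trans ?_)
        ((norm_div_pow_le _ hr0 hrw 5).trans ?_)
      · gcongr
        exact le_self_pow₀ hr (by norm_num)
      · gcongr
        exact le_self_pow₀ hr (by norm_num)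
    have h3 : ‖parabolicUDeriv α w‖ ≤ 3 * C * w.re := by
      have := norm_le_of_mem_quarterSector hw
      refine (hC w hw).2.trans ?_
      nlinarith
    refine (norm_sub_le _ _).trans ?_
    rw [norm_mul, norm_mul, hK₁, add_div]
    refine add_le_add ?_ ?_
    · calc _ ≤ (‖(4 : ℂ)‖ + ‖16 * α‖) / w.re ^ 2 * (3 * C * w.re) :=
            mul_le_mul h1 h3 (norm_nonneg _) (by positivity)
        _ = _ := by field_simp
    · rw [mul_div_right_comm]
      exact mul_le_mul h2 (hC w hw).1 (norm_nonneg _) (by positivity)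
  refine ⟨L, K₁ + 2 * (e * C), fun w hw hr => ⟨?_, ?_⟩⟩
  · have hr0 : 0 < w.re := by linarith
    calc ‖g w - L‖ = ‖H w + (g w - H w - L)‖ := by ring_nf
      _ ≤ K₁ / w.re + 2 * (e * C) / w.re ^ 3 := (norm_add_le _ _).trans
          (add_le_add (hHb w hw hr) (hrem w hw hr))
      _ ≤ K₁ / w.re + 2 * (e * C) / w.re := by
          gcongr
          exact le_self_pow₀ hr (by norm_num)
      _ = _ := by ring
  · have hr0 : 0 < w.re := by linarith
    refine (hrem w hw hr).trans ?_
    have : 0 ≤ K₁ := by positivity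
    gcongr
    linarith

/-! ### Improper integrals through primitives -/

theorem segmentIntegral_eq_sub {f g : ℂ → ℂ} (hf : Continuous f)
    (hg : ∀ z, HasDerivAt g (f z) z) (p q : ℂ) : segmentIntegral f p q = g q - g p := by
  have hline : ∀ s : ℝ, HasDerivAt (fun s : ℝ => g (p + s * (q - p)))
      (f (p + s * (q - p)) * (1 * (q - p))) s := fun s =>
    ((hg (p + (s : ℂ) * (q - p))).comp (s : ℂ)
      (((hasDerivAt_id (s : ℂ)).mul_const (q - p)).const_add p)).comp_ofReal
  have h := intervalIntegral.integral_eq_sub_of_hasDerivAt (a := 0) (b := 1)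
    (fun s _ => hline s) (Continuous.intervalIntegrable (by fun_prop) _ _)
  rw [intervalIntegral.integral_mul_const] at h
  rw [segmentIntegral]
  simp only [one_mul, Complex.ofReal_one, Complex.ofReal_zero, zero_mul, add_zero,
    add_sub_cancel] at h
  rw [← h, mul_comm]

theorem tendsto_segmentIntegral {f g : ℂ → ℂ} (hf : Continuous f)
    (hg : ∀ z, HasDerivAt g (f z) z) {θ : ℝ} {L : ℂ}
    (hL : Tendsto (fun R : ℝ => g (R * Complex.exp (Complex.I * θ))) atTop (𝓝 L)) (z : ℂ) :
    Tendsto (fun R : ℝ => segmentIntegral f (R * Complex.exp (Complex.I * θ)) z) atTop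
      (𝓝 (g z - L)) := by
  simp only [segmentIntegral_eq_sub hf hg]
  exact hL.const_sub _

theorem contourFromInfinity_eq {f g : ℂ → ℂ} (hf : Continuous f)
    (hg : ∀ z, HasDerivAt g (f z) z) {θ : ℝ} {L : ℂ}
    (hL : Tendsto (fun R : ℝ => g (R * Complex.exp (Complex.I * θ))) atTop (𝓝 L)) (z : ℂ) :
    contourFromInfinity f θ z = g z - L :=
  (tendsto_segmentIntegral hf hg hL z).limUnder_eq

theorem tendsto_intervalIntegral_of_primitive {f g : ℂ → ℂ} (hf : Continuous f)
    (hg : ∀ z, HasDerivAt g (f z) z) {L : ℂ}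
    (hL : Tendsto (fun R : ℝ => g R) atTop (𝓝 L)) (x : ℝ) :
    Tendsto (fun R : ℝ => ∫ t in x..R, f t) atTop (𝓝 (L - g x)) := by
  have h : ∀ R : ℝ, ∫ t in x..R, f t = g R - g x := fun R =>
    intervalIntegral.integral_eq_sub_of_hasDerivAt (f := fun t : ℝ => g t)
      (fun t _ => (hg t).comp_ofReal)
      (Continuous.intervalIntegrable (by fun_prop) _ _)
  simp only [h]
  exact hL.sub_const _

/-! ### Solutions of Weber's equation `y'' = (a - z²/4) y` -/

/-- The Wronskian of two solutions of `y'' = q y` is constant. -/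
theorem wronskian_eq_zero_value {q f f' g g' : ℂ → ℂ} (hf : ∀ z, HasDerivAt f (f' z) z)
    (hf' : ∀ z, HasDerivAt f' (q z * f z) z) (hg : ∀ z, HasDerivAt g (g' z) z)
    (hg' : ∀ z, HasDerivAt g' (q z * g z) z) (z : ℂ) :
    f z * g' z - f' z * g z = f 0 * g' 0 - f' 0 * g 0 := by
  have h : ∀ z, HasDerivAt (fun z => f z * g' z - f' z * g z) 0 z := fun z =>
    (((hf z).mul (hg' z)).sub ((hf' z).mul (hg z))).congr_deriv (by ring)
  exact is_const_of_deriv_eq_zero (fun z => (h z).differentiableAt) (fun z => (h z).deriv) z 0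

/-- The function `z ↦ U(α, ωz)`. Both `W_0` and `W_3` are of this form, with `ω² α = a` and
`ω⁴ = -1`. -/
def rotatedU (α ω z : ℂ) : ℂ := parabolicU α (z * ω)

/-- The derivative of `rotatedU α ω`. -/
def rotatedUDeriv (α ω z : ℂ) : ℂ := ω * parabolicUDeriv α (z * ω)

theorem hasDerivAt_rotatedU {α : ℂ} (hα : -(1 / 2) < α.re) (ω z : ℂ) :
    HasDerivAt (rotatedU α ω) (rotatedUDeriv α ω z) z := by
  have h := (hasDerivAt_parabolicU hα (z * ω)).comp z ((hasDerivAt_id z).mul_const ω)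
  exact h.congr_deriv (by rw [rotatedUDeriv]; ring)

theorem hasDerivAt_rotatedUDeriv {α a ω : ℂ} (hα : -(1 / 2) < α.re) (h4 : ω ^ 4 = -1)
    (h2 : ω ^ 2 * α = a) (z : ℂ) :
    HasDerivAt (rotatedUDeriv α ω) ((a - z ^ 2 / 4) * rotatedU α ω z) z := by
  have h := ((hasDerivAt_parabolicUDeriv hα (z * ω)).comp z
    ((hasDerivAt_id z).mul_const ω)).const_mul ω
  refine h.congr_deriv ?_
  rw [rotatedU]
  linear_combination (z ^ 2 / 4 * parabolicU α (z * ω)) * h4 + parabolicU α (z * ω) * h2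

/-- The truncated asymptotic series of the inhomogeneous solution `N̂_W`. -/
def nieldSeries (a : ℝ) (x : ℂ) : ℂ := 4 / x ^ 2 + 16 * a / x ^ 4

/-- The derivative of `nieldSeries a`. -/
def nieldSeriesDeriv (a : ℝ) (x : ℂ) : ℂ := -8 / x ^ 3 - 64 * a / x ^ 5

theorem exists_bound_rotatedU {α ω : ℂ} (hα : -(1 / 2) < α.re) (hω : ω ∈ quarterSector)
    (hn : ‖ω‖ = 1) :
    ∃ C : ℝ, ∀ x : ℝ, 0 ≤ x → ‖rotatedU α ω x‖ ≤ C ∧ ‖rotatedUDeriv α ω x‖ ≤ C * (1 + x) := by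
  obtain ⟨C, hC⟩ := exists_bound_parabolicU hα
  refine ⟨C, fun x hx => ?_⟩
  have hmem : (x : ℂ) * ω ∈ quarterSector := by
    simp only [quarterSector, Set.mem_ofPred_eq, Complex.re_ofReal_mul, Complex.im_ofReal_mul,
      abs_mul, abs_of_nonneg hx] at hω ⊢
    gcongr
  have h := hC _ hmem
  rw [norm_mul, hn, mul_one, Complex.norm_real, Real.norm_of_nonneg hx] at h
  refine ⟨h.1, ?_⟩
  rw [rotatedUDeriv, norm_mul, hn, one_mul]
  exact h.2

/-- A primitive of `U(α, ωz)` has the same limit along all rays that `ω` turns into the sector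
`|arg w| ≤ π/4`, and a refined expansion on the positive real axis. -/
theorem exists_primitive_rotatedU {α ω : ℂ} {a : ℝ} (hα : -(1 / 2) < α.re) (h4 : ω ^ 4 = -1)
    (h2 : ω ^ 2 * α = a) (hω : ω ∈ quarterSector) (hre : 1 / 2 ≤ ω.re) :
    ∃ (G : ℂ → ℂ) (L : ℂ) (K : ℝ), (∀ z, HasDerivAt G (rotatedU α ω z) z) ∧
      (∀ d : ℂ, d * ω ∈ quarterSector → 0 < (d * ω).re →
        Tendsto (fun R : ℝ => G (R * d)) atTop (𝓝 L)) ∧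
      ∀ x : ℝ, 2 ≤ x → ‖G x - (nieldSeriesDeriv a x * rotatedU α ω x -
        nieldSeries a x * rotatedUDeriv α ω x) - L‖ ≤ K / x ^ 3 := by
  have hω0 : ω ≠ 0 := by
    rintro rfl
    norm_num at h4
  obtain ⟨g, hg⟩ := Differentiable.isExactOn_univ
    (fun z => (hasDerivAt_parabolicU hα z).differentiableAt)
  replace hg := fun z => hg z (Set.mem_univ z)
  obtain ⟨L, K, hLK⟩ := exists_primitive_asymptotics hα hg
  refine ⟨fun z => g (z * ω) / ω, L / ω, ‖ω‖⁻¹ * (8 * K), fun z => ?_, fun d hd hd0 => ?_,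
    fun x hx => ?_⟩
  · refine (((hg (z * ω)).comp z ((hasDerivAt_id z).mul_const ω)).div_const ω).congr_deriv ?_
    rw [rotatedU]
    field_simp
  · refine Tendsto.div_const ?_ ω
    rw [tendsto_iff_norm_sub_tendsto_zero]
    have hlim : Tendsto (fun R : ℝ => K / (R * (d * ω).re)) atTop (𝓝 0) :=
      Tendsto.div_atTop tendsto_const_nhds (tendsto_id.atTop_mul_const hd0)
    refine squeeze_zero' (Eventually.of_forall fun _ => norm_nonneg _) ?_ hlim
    filter_upwards [eventually_ge_atTop (0 : ℝ), eventually_ge_atTop (1 / (d * ω).re)]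
      with R hR hR1
    have hre' : ((R : ℂ) * d * ω).re = R * (d * ω).re := by
      rw [mul_assoc, Complex.re_ofReal_mul]
    have hmem : (R : ℂ) * d * ω ∈ quarterSector := by
      rw [mul_assoc]
      simp only [quarterSector, Set.mem_ofPred_eq, Complex.re_ofReal_mul, Complex.im_ofReal_mul,
        abs_mul R, abs_of_nonneg hR] at hd ⊢
      gcongr
    have h := (hLK _ hmem (by rw [hre']; exact (div_le_iff₀ hd0).mp hR1)).1
    rwa [hre'] at h
  · have hx0 : 0 < x := by linarith
    have hxc : (x : ℂ) ≠ 0 := by exact_mod_cast hx0.ne'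
    have hre' : ((x : ℂ) * ω).re = x * ω.re := Complex.re_ofReal_mul _ _
    have hmem : (x : ℂ) * ω ∈ quarterSector := by
      simp only [quarterSector, Set.mem_ofPred_eq, Complex.re_ofReal_mul, Complex.im_ofReal_mul,
        abs_mul, abs_of_nonneg hx0.le] at hω ⊢
      gcongr
    have h := (hLK _ hmem (by rw [hre']; nlinarith)).2
    have hK : 0 ≤ K := by
      have := (norm_nonneg _).trans h
      rw [hre'] at this
      have hpos : 0 < (x * ω.re) ^ 3 := by positivity
      exact (div_nonneg_iff.mp this).elim (fun h => h.1) (fun h => absurd h.2 (not_le.mpr hpos))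
    have hsplit : g (x * ω) / ω - (nieldSeriesDeriv a x * rotatedU α ω x -
        nieldSeries a x * rotatedUDeriv α ω x) - L / ω =
        ω⁻¹ * (g (x * ω) - (seriesP α (x * ω) * parabolicUDeriv α (x * ω) -
          seriesPDeriv α (x * ω) * parabolicU α (x * ω)) - L) := by
      have e1 : seriesP α (x * ω) = -ω ^ 2 * nieldSeries a x := by
        rw [seriesP, nieldSeries, ← h2]
        field_simp
        linear_combination (4 * x ^ 2 * ω ^ 2 - 16 * α + 16 * α * ω ^ 4) * h4
      have e2 : seriesPDeriv α (x * ω) = -ω * nieldSeriesDeriv a x := by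
        rw [seriesPDeriv, nieldSeriesDeriv, ← h2]
        field_simp
        linear_combination (-8 * x ^ 2 * ω ^ 2 + 64 * α - 64 * α * ω ^ 4) * h4
      rw [e1, e2, rotatedU, rotatedUDeriv]
      field_simp
      ring
    rw [hsplit, norm_mul, norm_inv, mul_div_assoc]
    gcongr
    refine h.trans ?_
    rw [hre']
    calc K / (x * ω.re) ^ 3 ≤ K / (x * (1 / 2)) ^ 3 := by gcongr
      _ = 8 * K / x ^ 3 := by field_simp; norm_num

/-! ### `W_0` and `W_3`: initial values and Wronskian -/

theorem exp_pi_I_div_four_sq : Complex.exp (Real.pi * Complex.I / 4) ^ 2 = Complex.I := by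
  rw [← Complex.exp_nat_mul]
  refine (congrArg Complex.exp ?_).trans Complex.exp_pi_div_two_mul_I
  push_cast
  ring

theorem exp_neg_pi_I_div_four_sq :
    Complex.exp (-(Real.pi * Complex.I / 4)) ^ 2 = -Complex.I := by
  rw [Complex.exp_neg, inv_pow, exp_pi_I_div_four_sq, Complex.inv_I]

theorem exp_pi_I_div_four : Complex.exp (Real.pi * Complex.I / 4) =
    ((Real.sqrt 2 / 2 : ℝ) : ℂ) + ((Real.sqrt 2 / 2 : ℝ) : ℂ) * Complex.I := by
  have : (Real.pi * Complex.I / 4 : ℂ) = ((Real.pi / 4 : ℝ) : ℂ) * Complex.I := by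
    push_cast; ring
  rw [this, Complex.exp_mul_I, ← Complex.ofReal_cos, ← Complex.ofReal_sin, Real.cos_pi_div_four,
    Real.sin_pi_div_four]

theorem exp_neg_pi_I_div_four : Complex.exp (-(Real.pi * Complex.I / 4)) =
    ((Real.sqrt 2 / 2 : ℝ) : ℂ) - ((Real.sqrt 2 / 2 : ℝ) : ℂ) * Complex.I := by
  have : (-(Real.pi * Complex.I / 4) : ℂ) = ((-(Real.pi / 4) : ℝ) : ℂ) * Complex.I := by
    push_cast; ring
  rw [this, Complex.exp_mul_I, ← Complex.ofReal_cos, ← Complex.ofReal_sin, Real.cos_neg,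
    Real.sin_neg, Real.cos_pi_div_four, Real.sin_pi_div_four]
  push_cast
  ring

theorem weberWj_zero (a : ℝ) : weberWj 0 a =
    rotatedU (Complex.I * a) (Complex.exp (-(Real.pi * Complex.I / 4))) := by
  ext z
  simp [weberWj, rotatedU]

theorem weberWj_three (a : ℝ) : weberWj 3 a =
    rotatedU (-(Complex.I * a)) (Complex.exp (Real.pi * Complex.I / 4)) := by
  ext z
  have h : (-Complex.I) ^ 3 = Complex.exp (Real.pi * Complex.I / 4) ^ 2 := by
    rw [exp_pi_I_div_four_sq]
    linear_combination -Complex.I * Complex.I_sq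
  have h' : Complex.exp (Real.pi * Complex.I / 4) *
      Complex.exp (-(Real.pi * Complex.I / 4)) = 1 := by
    rw [← Complex.exp_add, add_neg_cancel, Complex.exp_zero]
  rw [weberWj, rotatedU, h]
  congr 1
  · ring
  · linear_combination z * Complex.exp (Real.pi * Complex.I / 4) * h'

/-- The derivative of `W_0(a, ·)`. -/
def weberW0Deriv (a : ℝ) : ℂ → ℂ :=
  rotatedUDeriv (Complex.I * a) (Complex.exp (-(Real.pi * Complex.I / 4)))

/-- The derivative of `W_3(a, ·)`. -/
def weberW3Deriv (a : ℝ) : ℂ → ℂ :=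
  rotatedUDeriv (-(Complex.I * a)) (Complex.exp (Real.pi * Complex.I / 4))

theorem neg_half_lt_re_I_mul (a : ℝ) : -(1 / 2) < (Complex.I * a).re := by simp

theorem neg_half_lt_re_neg_I_mul (a : ℝ) : -(1 / 2) < (-(Complex.I * a)).re := by simp

theorem hasDerivAt_weberWj_zero (a : ℝ) (z : ℂ) :
    HasDerivAt (weberWj 0 a) (weberW0Deriv a z) z := by
  rw [weberWj_zero]
  exact hasDerivAt_rotatedU (neg_half_lt_re_I_mul a) _ z

theorem hasDerivAt_weberWj_three (a : ℝ) (z : ℂ) :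
    HasDerivAt (weberWj 3 a) (weberW3Deriv a z) z := by
  rw [weberWj_three]
  exact hasDerivAt_rotatedU (neg_half_lt_re_neg_I_mul a) _ z

theorem hasDerivAt_weberW0Deriv (a : ℝ) (z : ℂ) :
    HasDerivAt (weberW0Deriv a) ((a - z ^ 2 / 4) * weberWj 0 a z) z := by
  rw [weberWj_zero]
  refine hasDerivAt_rotatedUDeriv (neg_half_lt_re_I_mul a) ?_ ?_ z
  · rw [show 4 = 2 * 2 by rfl, pow_mul, exp_neg_pi_I_div_four_sq, neg_sq, Complex.I_sq]
  · rw [exp_neg_pi_I_div_four_sq]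
    linear_combination -(a : ℂ) * Complex.I_sq

theorem hasDerivAt_weberW3Deriv (a : ℝ) (z : ℂ) :
    HasDerivAt (weberW3Deriv a) ((a - z ^ 2 / 4) * weberWj 3 a z) z := by
  rw [weberWj_three]
  refine hasDerivAt_rotatedUDeriv (neg_half_lt_re_neg_I_mul a) ?_ ?_ z
  · rw [show 4 = 2 * 2 by rfl, pow_mul, exp_pi_I_div_four_sq, Complex.I_sq]
  · rw [exp_pi_I_div_four_sq]
    linear_combination -(a : ℂ) * Complex.I_sq

/-- By the reflection formula for `Γ`, applied at `1/4 + α/2` and at `1/2 + α`, and the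
duplication formula of the sine. -/
theorem parabolicU_zero_mul_parabolicUDeriv_neg_zero {α : ℂ} (h1 : -(1 / 2) < α.re)
    (h2 : α.re < 1 / 2) :
    parabolicU α 0 * parabolicUDeriv (-α) 0 = -Complex.cos (Real.pi * (1 / 4 + α / 2)) := by
  set s : ℂ := α / 2 + 1 / 4 with hs
  have hre : s.re = α.re / 2 + 1 / 4 := by
    rw [hs]
    simp [show (2 : ℂ) = ((2 : ℝ) : ℂ) by norm_num, Complex.div_ofReal_re, -Complex.ofReal_ofNat]
  have g1 : Complex.Gamma s ≠ 0 := Complex.Gamma_ne_zero_of_re_pos (by rw [hre]; linarith)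
  have g2 : Complex.Gamma (1 - s) ≠ 0 := Complex.Gamma_ne_zero_of_re_pos (by
    rw [Complex.sub_re, hre, Complex.one_re]; linarith)
  have g3 : Complex.Gamma (2 * s) ≠ 0 := Complex.Gamma_ne_zero_of_re_pos (by
    simp [hre]; linarith)
  have g4 : Complex.Gamma (1 - 2 * s) ≠ 0 := Complex.Gamma_ne_zero_of_re_pos (by
    simp [hre]; linarith)
  have r1 := Complex.Gamma_mul_Gamma_one_sub s
  have r2 := Complex.Gamma_mul_Gamma_one_sub (2 * s)
  have s1 : Complex.sin (Real.pi * s) ≠ 0 := fun h => by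
    rw [h, div_zero] at r1
    exact mul_ne_zero g1 g2 r1
  have hpi : (Real.pi : ℂ) ≠ 0 := by exact_mod_cast Real.pi_ne_zero
  rw [show (Real.pi : ℂ) * (2 * s) = 2 * (Real.pi * s) by ring, Complex.sin_two_mul] at r2
  have c1 : Complex.cos (Real.pi * s) ≠ 0 := fun h => by
    rw [h, mul_zero, div_zero] at r2
    exact mul_ne_zero g3 g4 r2
  have hp : (2 : ℂ) ^ (α / 2 - 3 / 4) * 2 ^ (-α / 2 - 1 / 4) = 1 / 2 := by
    rw [← Complex.cpow_add _ _ two_ne_zero,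
      show α / 2 - 3 / 4 + (-α / 2 - 1 / 4) = -1 by ring, Complex.cpow_neg_one, one_div]
  rw [parabolicU_zero h1, parabolicUDeriv_zero (by simpa using h2),
    show 1 / 2 + α = 2 * s by rw [hs]; ring, show 1 / 2 + -α = 1 - 2 * s by rw [hs]; ring,
    show -α / 2 + 3 / 4 = 1 - s by rw [hs]; ring, show 1 / 4 + α / 2 = s by rw [hs]; ring]
  calc _ = -((2 : ℂ) ^ (α / 2 - 3 / 4) * 2 ^ (-α / 2 - 1 / 4)) *
        (Complex.Gamma s * Complex.Gamma (1 - s)) /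
        (Complex.Gamma (2 * s) * Complex.Gamma (1 - 2 * s)) := by ring
    _ = _ := by
      rw [hp, r1, r2]
      field_simp

/-- At `0` the Wronskian is a difference of two values of
`parabolicU_zero_mul_parabolicUDeriv_neg_zero`, for `α = ia` and `α = -ia`. -/
theorem weberWj_wronskian (a : ℝ) (z : ℂ) :
    weberWj 0 a z * weberW3Deriv a z - weberW0Deriv a z * weberWj 3 a z =
      -Complex.I * Complex.exp (-(Real.pi * a / 2)) := by
  rw [wronskian_eq_zero_value (hasDerivAt_weberWj_zero a) (hasDerivAt_weberW0Deriv a)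
    (hasDerivAt_weberWj_three a) (hasDerivAt_weberW3Deriv a)]
  have h1 := parabolicU_zero_mul_parabolicUDeriv_neg_zero (α := Complex.I * a)
    (by simp) (by simp)
  have h2 := parabolicU_zero_mul_parabolicUDeriv_neg_zero (α := -(Complex.I * a))
    (by simp) (by simp)
  rw [neg_neg] at h2
  set ω := Complex.exp (Real.pi * Complex.I / 4) with hω
  set y := Complex.exp (Real.pi * a / 2) with hy
  have c1 : Complex.cos (Real.pi * (1 / 4 + Complex.I * a / 2)) = (ω * y⁻¹ + ω⁻¹ * y) / 2 := by
    rw [Complex.cos, hω, hy, ← Complex.exp_neg, ← Complex.exp_neg, ← Complex.exp_add,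
      ← Complex.exp_add]
    congr 3 <;> linear_combination (norm := ring_nf) (Real.pi * a / 2 : ℂ) * Complex.I_sq
    all_goals simp
  have c2 : Complex.cos (Real.pi * (1 / 4 + -(Complex.I * a) / 2)) =
      (ω * y + ω⁻¹ * y⁻¹) / 2 := by
    rw [Complex.cos, hω, hy, ← Complex.exp_neg, ← Complex.exp_neg, ← Complex.exp_add,
      ← Complex.exp_add]
    congr 3 <;> linear_combination (norm := ring_nf) (-Real.pi * a / 2 : ℂ) * Complex.I_sq
    all_goals simp
  rw [c1] at h1
  rw [c2] at h2
  have hI : ω ^ 2 = Complex.I := exp_pi_I_div_four_sq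
  have hI' : ω⁻¹ ^ 2 = -Complex.I := by rw [inv_pow, hI, Complex.inv_I]
  rw [weberWj_zero, weberWj_three, weberW0Deriv, weberW3Deriv]
  simp only [rotatedU, rotatedUDeriv, zero_mul]
  rw [Complex.exp_neg, Complex.exp_neg, ← hω, ← hy]
  linear_combination ω * h1 - ω⁻¹ * h2 - y⁻¹ / 2 * hI + y⁻¹ / 2 * hI'

/-! ### The connection formula for `W(a, -z)` -/

theorem weberK_pos (a : ℝ) : 0 < weberK a := by
  rw [weberK, sub_pos]
  refine Real.lt_sqrt_of_sq_lt ?_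
  rw [← Real.exp_nat_mul]
  have : ((2 : ℕ) : ℝ) * (Real.pi * a) = 2 * Real.pi * a := by push_cast; ring
  rw [this]
  linarith

/-- `k` is the tangent of half the argument of `e^{πa} + i`. -/
theorem one_add_weberK_mul_I_sq (a : ℝ) :
    (1 + weberK a * Complex.I) ^ 2 = 2 * weberK a * (Real.exp (Real.pi * a) + Complex.I) := by
  have h : weberK a ^ 2 + 2 * weberK a * Real.exp (Real.pi * a) = 1 := by
    have h1 : Real.sqrt (1 + Real.exp (2 * Real.pi * a)) ^ 2 =
        1 + Real.exp (Real.pi * a) ^ 2 := by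
      rw [Real.sq_sqrt (by positivity), ← Real.exp_nat_mul]
      congr 2
      push_cast
      ring
    rw [weberK]
    linear_combination h1
  have hc : (weberK a : ℂ) ^ 2 + 2 * weberK a * (Real.exp (Real.pi * a) : ℝ) = 1 := by
    exact_mod_cast h
  linear_combination (weberK a : ℂ) ^ 2 * Complex.I_sq - hc

/-- The phase of `Γ(1/4 + ia/2) / Γ(3/4 + ia/2)`. -/
theorem exists_Gamma_div_Gamma (a : ℝ) : ∃ l : ℝ, 0 < l ∧
    Complex.exp (Real.pi * Complex.I / 4) * Complex.Gamma (Complex.I * a / 2 + 1 / 4) /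
      Complex.Gamma (Complex.I * a / 2 + 3 / 4) = l * (1 + weberK a * Complex.I) ^ 2 := by
  set s : ℂ := Complex.I * a / 2 + 1 / 4 with hs
  set ω := Complex.exp (Real.pi * Complex.I / 4) with hω
  set y := Real.exp (Real.pi * a / 2) with hy
  have hy0 : 0 < y := Real.exp_pos _
  have hω0 : ω ≠ 0 := Complex.exp_ne_zero _
  have hconj : Complex.Gamma (Complex.I * a / 2 + 3 / 4) =
      (starRingEnd ℂ) (Complex.Gamma (1 - s)) := by
    have : 1 - s = ((3 / 4 : ℝ) : ℂ) - ((a / 2 : ℝ) : ℂ) * Complex.I := by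
      rw [hs]; push_cast; ring
    rw [← Complex.Gamma_conj, this, map_sub, map_mul, Complex.conj_ofReal, Complex.conj_ofReal,
      Complex.conj_I]
    congr 1
    push_cast
    ring
  have hre : s.re = 1 / 4 := by
    rw [hs]
    simp [show (2 : ℂ) = ((2 : ℝ) : ℂ) by norm_num, Complex.div_ofReal_re, -Complex.ofReal_ofNat]
  have g2 : Complex.Gamma (1 - s) ≠ 0 := Complex.Gamma_ne_zero_of_re_pos (by
    rw [Complex.sub_re, hre, Complex.one_re]; norm_num)
  have g1 : Complex.Gamma s ≠ 0 := Complex.Gamma_ne_zero_of_re_pos (by rw [hre]; norm_num)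
  have r1 := Complex.Gamma_mul_Gamma_one_sub s
  have s1 : Complex.sin (Real.pi * s) ≠ 0 := fun h => by
    rw [h, div_zero] at r1
    exact mul_ne_zero g1 g2 r1
  have hsin : Complex.sin (Real.pi * s) = (ω⁻¹ * y - ω * (y : ℂ)⁻¹) * Complex.I / 2 := by
    rw [Complex.sin, hω, hy, Complex.ofReal_exp, ← Complex.exp_neg, ← Complex.exp_neg,
      ← Complex.exp_add, ← Complex.exp_add, hs]
    push_cast
    congr 4 <;> linear_combination (norm := ring_nf) (Real.pi * a / 2 : ℂ) * Complex.I_sq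
    all_goals simp
  have hω2 : ω ^ 2 = Complex.I := exp_pi_I_div_four_sq
  set n : ℝ := Complex.normSq (Complex.Gamma (1 - s)) with hn
  have hn0 : 0 < n := Complex.normSq_pos.mpr g2
  have hk := weberK_pos a
  have hE : Real.exp (Real.pi * a) = y ^ 2 := by
    rw [hy, ← Real.exp_nat_mul]
    congr 1
    push_cast
    ring
  have hyc : (y : ℂ) ≠ 0 := by exact_mod_cast hy0.ne'
  have hnc : (n : ℂ) ≠ 0 := by exact_mod_cast hn0.ne'
  have hkc : (weberK a : ℂ) ≠ 0 := by exact_mod_cast hk.ne'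
  refine ⟨2 * Real.pi * y / (n * (y ^ 4 + 1)) / (2 * weberK a), by positivity, ?_⟩
  have hmul : Complex.Gamma (1 - s) * (starRingEnd ℂ) (Complex.Gamma (1 - s)) = n :=
    Complex.mul_conj _
  have hstar : (starRingEnd ℂ) (Complex.Gamma (1 - s)) ≠ 0 := by
    rwa [Ne, map_eq_zero]
  have hy4 : ((y : ℂ) ^ 4 + 1) ≠ 0 := by
    have : y ^ 4 + 1 ≠ 0 := by positivity
    exact_mod_cast this
  have key : ω * Complex.Gamma s / (starRingEnd ℂ) (Complex.Gamma (1 - s)) =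
      ω * (Real.pi / Complex.sin (Real.pi * s)) / n := by
    rw [← r1, ← hmul]
    field_simp
  rw [hconj, key, one_add_weberK_mul_I_sq, hE]
  have hs2 : ω * Complex.sin (Real.pi * s) * (2 * y) = (y ^ 2 * Complex.I + 1) := by
    rw [hsin]
    field_simp
    linear_combination -Complex.I * hω2 - Complex.I_sq
  have hfrac : ω * (Real.pi / Complex.sin (Real.pi * s)) =
      Real.pi * ω ^ 2 * (2 * y) / (y ^ 2 * Complex.I + 1) := by
    rw [← hs2]
    field_simp
  have hne : (y : ℂ) ^ 2 * Complex.I + 1 ≠ 0 := by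
    rw [← hs2]
    exact mul_ne_zero (mul_ne_zero hω0 s1) (by simpa using hyc)
  rw [hfrac, hω2]
  push_cast
  field_simp
  rw [div_eq_iff (by rwa [mul_comm Complex.I])]
  linear_combination (-(y : ℂ) ^ 2) * Complex.I_sq

/-- The initial values of `U(ia, ·)`, rotated by `e^{iρ}`: their squares are the positive
multiples `√π / (2|Γ(1/2 + ia)|)` and `√π / |Γ(1/2 + ia)|` of the quotient of
`exists_Gamma_div_Gamma` and of its inverse, by the duplication formula. -/
theorem exists_sq_initial_values (a : ℝ) : ∃ l m : ℝ, 0 < l ∧ 0 < m ∧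
    (Complex.exp (Complex.I * weberRho a) * weberWj 0 a 0) ^ 2 =
      l * (1 + weberK a * Complex.I) ^ 2 ∧
    (Complex.exp (Complex.I * weberRho a) * weberW0Deriv a 0) ^ 2 =
      m * (1 - weberK a * Complex.I) ^ 2 := by
  obtain ⟨l, hl, hX⟩ := exists_Gamma_div_Gamma a
  set α : ℂ := Complex.I * a with hα
  set ω := Complex.exp (Real.pi * Complex.I / 4) with hω
  set k : ℝ := weberK a with hk
  have hω0 : ω ≠ 0 := Complex.exp_ne_zero _
  set T : ℂ := 2 ^ (α / 2) with hT
  set c : ℂ := 2 ^ (1 / 4 : ℂ) with hc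
  have hT0 : T ≠ 0 := by simp [hT, Complex.cpow_eq_zero_iff]
  have hc0 : c ≠ 0 := by simp [hc, Complex.cpow_eq_zero_iff]
  have hc4 : c ^ 4 = 2 := by
    rw [hc, ← Complex.cpow_nat_mul]
    norm_num
  have hp1 : (2 : ℂ) ^ (α / 2 - 3 / 4) = T * c / 2 := by
    rw [show α / 2 - 3 / 4 = α / 2 + 1 / 4 - 1 by ring, Complex.cpow_sub _ _ two_ne_zero,
      Complex.cpow_add _ _ two_ne_zero, Complex.cpow_one]
  have hp2 : (2 : ℂ) ^ (α / 2 - 1 / 4) = T * c ^ 3 / 2 := by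
    have h3 : (2 : ℂ) ^ (3 / 4 : ℂ) = c ^ 3 := by
      rw [hc, ← Complex.cpow_nat_mul]
      norm_num
    rw [show α / 2 - 1 / 4 = α / 2 + 3 / 4 - 1 by ring, Complex.cpow_sub _ _ two_ne_zero,
      Complex.cpow_add _ _ two_ne_zero, Complex.cpow_one, h3]
  have hp3 : T ^ 2 * (2 : ℂ) ^ (1 / 2 - α) = c ^ 2 := by
    rw [hT, hc, ← Complex.cpow_nat_mul, ← Complex.cpow_nat_mul,
      ← Complex.cpow_add _ _ two_ne_zero]
    congr 1
    push_cast
    ring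
  set g₁ := Complex.Gamma (α / 2 + 1 / 4) with hg₁
  set g₃ := Complex.Gamma (α / 2 + 3 / 4) with hg₃
  set N := Complex.Gamma (1 / 2 + α) with hN
  have hdup : g₁ * g₃ * T ^ 2 = N * c ^ 2 * (Real.sqrt Real.pi : ℝ) := by
    have h := Complex.Gamma_mul_Gamma_add_half (α / 2 + 1 / 4)
    rw [show α / 2 + 1 / 4 + 1 / 2 = α / 2 + 3 / 4 by ring,
      show 2 * (α / 2 + 1 / 4) = 1 / 2 + α by ring,
      show 1 - (1 / 2 + α) = 1 / 2 - α by ring] at h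
    linear_combination T ^ 2 * h + N * (Real.sqrt Real.pi : ℝ) * hp3
  have hN0 : N ≠ 0 := Complex.Gamma_ne_zero_of_re_pos (by simp [hα])
  have hsqrt : (0 : ℝ) < Real.sqrt Real.pi := Real.sqrt_pos.mpr Real.pi_pos
  have hsqrtc : ((Real.sqrt Real.pi : ℝ) : ℂ) ≠ 0 := by exact_mod_cast hsqrt.ne'
  have hprod : g₁ * g₃ * T ^ 2 ≠ 0 := by
    rw [hdup]
    exact mul_ne_zero (mul_ne_zero hN0 (pow_ne_zero 2 hc0)) hsqrtc
  have hg₁0 : g₁ ≠ 0 := fun h => hprod (by rw [h]; ring)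
  have hg₃0 : g₃ ≠ 0 := fun h => hprod (by rw [h]; ring)
  have hphase := Gamma_eq_norm_mul_exp_weberPhi a
  rw [← hα, ← hN] at hphase
  set E := Complex.exp (Complex.I * weberPhi a) with hE
  have hnorm : (0 : ℝ) < ‖N‖ := norm_pos_iff.mpr hN0
  have hnormc : ((‖N‖ : ℝ) : ℂ) ≠ 0 := by exact_mod_cast hnorm.ne'
  have hrho : Complex.exp (Complex.I * weberRho a) ^ 2 = E * ω := by
    rw [hE, hω, ← Complex.exp_add, ← Complex.exp_nat_mul, weberRho]
    congr 1
    push_cast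
    ring
  have hEN : E / N = 1 / (‖N‖ : ℝ) := by
    rw [div_eq_div_iff hN0 hnormc]
    linear_combination -hphase
  have hcN : c ^ 2 / N = g₁⁻¹ * g₃⁻¹ * (T ^ 2)⁻¹ * c ^ 4 * (Real.sqrt Real.pi : ℝ) := by
    rw [← mul_inv, ← mul_inv, hdup]
    field_simp
  have hk2 : (1 + (k : ℂ) ^ 2) ≠ 0 := by
    have : 1 + k ^ 2 ≠ 0 := by positivity
    exact_mod_cast this
  have hfac : (1 + k * Complex.I) * (1 - k * Complex.I) = 1 + (k : ℂ) ^ 2 := by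
    linear_combination -(k : ℂ) ^ 2 * Complex.I_sq
  have hre := neg_half_lt_re_I_mul a
  refine ⟨Real.sqrt Real.pi / (2 * ‖N‖) * l,
    Real.sqrt Real.pi / ‖N‖ * (l⁻¹ / (1 + k ^ 2) ^ 2), by positivity, by positivity, ?_, ?_⟩
  · rw [weberWj_zero, mul_pow, hrho]
    simp only [rotatedU, zero_mul]
    rw [parabolicU_zero hre, ← hα, ← hN, ← hg₁, hp1]
    calc E * ω * (T * c / 2 * g₁ / N) ^ 2
        = (E / N) * (c ^ 2 / N) * (ω * T ^ 2 * g₁ ^ 2 / 4) := by ring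
      _ = Real.sqrt Real.pi / (2 * (‖N‖ : ℝ)) * (ω * g₁ / g₃) := by
        rw [hEN, hcN, hc4]
        field_simp
        norm_num
      _ = _ := by
        rw [hX]
        push_cast
        ring
  · rw [weberW0Deriv, mul_pow, hrho]
    simp only [rotatedUDeriv, zero_mul]
    rw [parabolicUDeriv_zero hre, ← hα, ← hN, ← hg₃, hp2, Complex.exp_neg, ← hω]
    have h1 : (1 + k * Complex.I) ≠ 0 := fun h => hk2 (by rw [← hfac, h, zero_mul])
    have h1' : (1 - k * Complex.I) ≠ 0 := fun h => hk2 (by rw [← hfac, h, mul_zero])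
    have hlc : (l : ℂ) ≠ 0 := by exact_mod_cast hl.ne'
    calc E * ω * (ω⁻¹ * -(T * c ^ 3 / 2 * g₃ / N)) ^ 2
        = (E / N) * (c ^ 2 / N) * c ^ 4 * (ω * ω⁻¹ ^ 2 * T ^ 2 * g₃ ^ 2 / 4) := by ring
      _ = Real.sqrt Real.pi / (‖N‖ : ℝ) * (ω * g₁ / g₃)⁻¹ := by
        rw [hEN, hcN, hc4]
        field_simp
        norm_num
      _ = _ := by
        rw [hX]
        push_cast
        rw [← hfac]
        field_simp

/-- A complex number whose square is a positive multiple of `c²` is a real multiple of `c`. -/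
theorem exists_real_mul_of_sq_eq {z c : ℂ} {l : ℝ} (hl : 0 < l) (h : z ^ 2 = l * c ^ 2) :
    ∃ r : ℝ, z = r * c := by
  have h' : z ^ 2 = ((Real.sqrt l : ℝ) * c) ^ 2 := by
    rw [h, mul_pow, ← Complex.ofReal_pow, Real.sq_sqrt hl.le]
  rcases sq_eq_sq_iff_eq_or_eq_neg.mp h' with h | h
  · exact ⟨_, h⟩
  · exact ⟨-Real.sqrt l, by rw [h]; push_cast; ring⟩

theorem conj_two_cpow (s : ℂ) : (2 : ℂ) ^ (starRingEnd ℂ) s = (starRingEnd ℂ) ((2 : ℂ) ^ s) := by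
  have h := Complex.cpow_conj 2 s (by
    rw [show (2 : ℂ) = ((2 : ℝ) : ℂ) by norm_num, Complex.arg_ofReal_of_nonneg zero_le_two]
    exact Real.pi_ne_zero.symm)
  rw [h, map_ofNat]

theorem weberWj_three_zero (a : ℝ) : weberWj 3 a 0 = (starRingEnd ℂ) (weberWj 0 a 0) := by
  rw [weberWj_zero, weberWj_three]
  simp only [rotatedU, zero_mul]
  rw [parabolicU_zero (neg_half_lt_re_I_mul a), parabolicU_zero (neg_half_lt_re_neg_I_mul a),
    map_div₀, map_mul, ← conj_two_cpow, ← Complex.Gamma_conj, ← Complex.Gamma_conj]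
  simp [map_ofNat]

theorem weberW3Deriv_zero (a : ℝ) :
    weberW3Deriv a 0 = (starRingEnd ℂ) (weberW0Deriv a 0) := by
  rw [weberW0Deriv, weberW3Deriv]
  simp only [rotatedUDeriv, zero_mul]
  rw [parabolicUDeriv_zero (neg_half_lt_re_I_mul a),
    parabolicUDeriv_zero (neg_half_lt_re_neg_I_mul a),
    map_mul, map_neg, map_div₀, map_mul, ← conj_two_cpow, ← Complex.Gamma_conj,
    ← Complex.Gamma_conj, ← Complex.exp_conj]
  simp [map_ofNat, neg_div]

/-- A solution of Weber's equation with vanishing initial values vanishes, because its Wronskians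
with `W_0` and `W_3` do. -/
theorem eq_zero_of_initial_values {a : ℝ} {f f' : ℂ → ℂ} (hf : ∀ z, HasDerivAt f (f' z) z)
    (hf' : ∀ z, HasDerivAt f' ((a - z ^ 2 / 4) * f z) z) (h0 : f 0 = 0) (h0' : f' 0 = 0) (z : ℂ) :
    f z = 0 := by
  have h1 := wronskian_eq_zero_value hf hf' (hasDerivAt_weberWj_zero a)
    (hasDerivAt_weberW0Deriv a) z
  have h2 := wronskian_eq_zero_value hf hf' (hasDerivAt_weberWj_three a)
    (hasDerivAt_weberW3Deriv a) z
  have h3 := weberWj_wronskian a z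
  rw [h0, h0', zero_mul, zero_mul, sub_zero] at h1 h2
  have h4 : f z * (-Complex.I * Complex.exp (-(Real.pi * a / 2))) = 0 := by
    linear_combination (-f z) * h3 + weberWj 0 a z * h2 - weberWj 3 a z * h1
  exact (mul_eq_zero.mp h4).resolve_right
    (mul_ne_zero (neg_ne_zero.mpr Complex.I_ne_zero) (Complex.exp_ne_zero _))

/-- The real amplitude `√(k/2) e^{πa/4}` of the Weber function. -/
def weberAmplitude (a : ℝ) : ℝ := Real.sqrt (weberK a / 2) * Real.exp (Real.pi * a / 4)

theorem weberAmplitude_sq (a : ℝ) :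
    weberAmplitude a ^ 2 = weberK a / 2 * Real.exp (Real.pi * a / 2) := by
  rw [weberAmplitude, mul_pow, Real.sq_sqrt (by have := weberK_pos a; positivity),
    ← Real.exp_nat_mul]
  congr 2
  push_cast
  ring

theorem weberW_eq (a : ℝ) (z : ℂ) :
    weberW a z = weberAmplitude a * (Complex.exp (Complex.I * weberRho a) * weberWj 0 a z +
      Complex.exp (-(Complex.I * weberRho a)) * weberWj 3 a z) := rfl

/-- The connection formula: `k` and `ρ` are chosen such that both sides have the same value and
the same derivative at `0`. -/
theorem weberW_neg (a : ℝ) (z : ℂ) :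
    weberW a (-z) = -Complex.I * (weberAmplitude a / weberK a) *
      (Complex.exp (Complex.I * weberRho a) * weberWj 0 a z -
        Complex.exp (-(Complex.I * weberRho a)) * weberWj 3 a z) := by
  set A : ℂ := ((weberAmplitude a : ℝ) : ℂ)
  set k : ℂ := ((weberK a : ℝ) : ℂ) with hk
  have hk0 : k ≠ 0 := by
    rw [hk]
    exact_mod_cast (weberK_pos a).ne'
  set e := Complex.exp (Complex.I * weberRho a) with he
  set e' := Complex.exp (-(Complex.I * weberRho a)) with he'
  have hconj : e' = (starRingEnd ℂ) e := by
    rw [he, he', ← Complex.exp_conj]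
    simp
  obtain ⟨l, m, hl, hm, h1, h2⟩ := exists_sq_initial_values a
  obtain ⟨r, hr⟩ := exists_real_mul_of_sq_eq hl h1
  obtain ⟨t, ht⟩ := exists_real_mul_of_sq_eq hm h2
  rw [← he, ← hk] at hr ht
  have hr' : e' * weberWj 3 a 0 = r * (1 - k * Complex.I) := by
    rw [weberWj_three_zero, hconj, ← map_mul, hr, hk, map_mul, map_add, map_mul, map_one,
      Complex.conj_ofReal, Complex.conj_ofReal, Complex.conj_I]
    ring
  have ht' : e' * weberW3Deriv a 0 = t * (1 + k * Complex.I) := by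
    rw [weberW3Deriv_zero, hconj, ← map_mul, ht, hk]
    simp
  set f : ℂ → ℂ := fun z => A * (e * weberWj 0 a (-z) + e' * weberWj 3 a (-z)) -
    -Complex.I * (A / k) * (e * weberWj 0 a z - e' * weberWj 3 a z) with hf
  set f' : ℂ → ℂ := fun z => A * (e * -weberW0Deriv a (-z) + e' * -weberW3Deriv a (-z)) -
    -Complex.I * (A / k) * (e * weberW0Deriv a z - e' * weberW3Deriv a z) with hf'
  have hneg : ∀ {g g' : ℂ → ℂ}, (∀ z, HasDerivAt g (g' z) z) → ∀ z,
      HasDerivAt (fun z => g (-z)) (-g' (-z)) z := fun hg z =>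
    ((hg (-z)).comp z (hasDerivAt_neg z)).congr_deriv (by ring)
  have d0 := hasDerivAt_weberWj_zero a
  have d3 := hasDerivAt_weberWj_three a
  have d0' := hasDerivAt_weberW0Deriv a
  have d3' := hasDerivAt_weberW3Deriv a
  have hzero := eq_zero_of_initial_values (a := a) (f := f) (f' := f')
    (fun z => ((((hneg d0 z).const_mul e).add ((hneg d3 z).const_mul e')).const_mul A).sub
      ((((d0 z).const_mul e).sub ((d3 z).const_mul e')).const_mul _))
    (fun z => (((((hneg d0' z).fun_neg.const_mul e).add
      ((hneg d3' z).fun_neg.const_mul e')).const_mul A).sub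
      ((((d0' z).const_mul e).sub ((d3' z).const_mul e')).const_mul _)).congr_deriv (by
        simp only [hf]
        ring))
    (by
      simp only [hf, neg_zero, hr, hr']
      field_simp
      linear_combination (2 * r * A * k : ℂ) * Complex.I_sq)
    (by
      simp only [hf', neg_zero, mul_neg, ht, ht']
      field_simp
      linear_combination (-2 * t * A * k : ℂ) * Complex.I_sq) z
  rw [weberW_eq]
  linear_combination hzero

/-! ### The Nield–Kuznetsov function through primitives that vanish at infinity -/

theorem exp_pi_I_div_four_mem : Complex.exp (Real.pi * Complex.I / 4) ∈ quarterSector ∧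
    1 / 2 ≤ (Complex.exp (Real.pi * Complex.I / 4)).re := by
  rw [exp_pi_I_div_four]
  have h : (1 : ℝ) ≤ Real.sqrt 2 := Real.one_le_sqrt.mpr one_le_two
  constructor
  · simp [quarterSector, abs_of_pos]
  · simp only [Complex.add_re, Complex.ofReal_re, Complex.re_ofReal_mul, Complex.I_re]
    linarith

theorem exp_neg_pi_I_div_four_mem :
    Complex.exp (-(Real.pi * Complex.I / 4)) ∈ quarterSector ∧
      1 / 2 ≤ (Complex.exp (-(Real.pi * Complex.I / 4))).re := by
  rw [exp_neg_pi_I_div_four]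
  have h : (1 : ℝ) ≤ Real.sqrt 2 := Real.one_le_sqrt.mpr one_le_two
  constructor
  · simp [quarterSector, abs_of_pos]
  · simp only [Complex.sub_re, Complex.ofReal_re, Complex.re_ofReal_mul, Complex.I_re]
    linarith

/-- A primitive of `W_0(a, ·)` that vanishes at `+∞` and at `e^{πi/4}∞`. -/
theorem exists_primitive_weberWj_zero (a : ℝ) : ∃ (G : ℂ → ℂ) (K : ℝ),
    (∀ z, HasDerivAt G (weberWj 0 a z) z) ∧
    Tendsto (fun R : ℝ => G R) atTop (𝓝 0) ∧
    Tendsto (fun R : ℝ => G (R * Complex.exp (Complex.I * (Real.pi / 4 : ℝ)))) atTop (𝓝 0) ∧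
    ∀ x : ℝ, 2 ≤ x → ‖G x - (nieldSeriesDeriv a x * weberWj 0 a x -
      nieldSeries a x * weberW0Deriv a x)‖ ≤ K / x ^ 3 := by
  have hω := exp_neg_pi_I_div_four_mem
  obtain ⟨G, L, K, h1, h2, h3⟩ := exists_primitive_rotatedU (neg_half_lt_re_I_mul a)
    (by rw [show 4 = 2 * 2 by rfl, pow_mul, exp_neg_pi_I_div_four_sq, neg_sq, Complex.I_sq])
    (by rw [exp_neg_pi_I_div_four_sq]; linear_combination -(a : ℂ) * Complex.I_sq) hω.1 hω.2
  rw [weberWj_zero]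
  refine ⟨fun z => G z - L, K, fun z => (h1 z).sub_const L, ?_, ?_, fun x hx => ?_⟩
  · have := (h2 1 (by simpa using hω.1) (by rw [one_mul]; linarith [hω.2])).sub_const L
    simpa using this
  · have hd : Complex.exp (Complex.I * (Real.pi / 4 : ℝ)) *
        Complex.exp (-(Real.pi * Complex.I / 4)) = 1 := by
      rw [← Complex.exp_add, ← Complex.exp_zero]
      congr 1
      push_cast
      ring
    have := (h2 (Complex.exp (Complex.I * (Real.pi / 4 : ℝ))) (by rw [hd]; simp [quarterSector])
      (by rw [hd]; simp)).sub_const L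
    simpa using this
  · convert h3 x hx using 2
    rw [weberW0Deriv]
    ring

/-- A primitive of `W_3(a, ·)` that vanishes at `+∞` and at `e^{-πi/4}∞`. -/
theorem exists_primitive_weberWj_three (a : ℝ) : ∃ (G : ℂ → ℂ) (K : ℝ),
    (∀ z, HasDerivAt G (weberWj 3 a z) z) ∧
    Tendsto (fun R : ℝ => G R) atTop (𝓝 0) ∧
    Tendsto (fun R : ℝ => G (R * Complex.exp (Complex.I * (-(Real.pi / 4) : ℝ)))) atTop (𝓝 0) ∧
    ∀ x : ℝ, 2 ≤ x → ‖G x - (nieldSeriesDeriv a x * weberWj 3 a x -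
      nieldSeries a x * weberW3Deriv a x)‖ ≤ K / x ^ 3 := by
  have hω := exp_pi_I_div_four_mem
  obtain ⟨G, L, K, h1, h2, h3⟩ := exists_primitive_rotatedU (neg_half_lt_re_neg_I_mul a)
    (by rw [show 4 = 2 * 2 by rfl, pow_mul, exp_pi_I_div_four_sq, Complex.I_sq])
    (by rw [exp_pi_I_div_four_sq]; linear_combination -(a : ℂ) * Complex.I_sq) hω.1 hω.2
  rw [weberWj_three]
  refine ⟨fun z => G z - L, K, fun z => (h1 z).sub_const L, ?_, ?_, fun x hx => ?_⟩
  · have := (h2 1 (by simpa using hω.1) (by rw [one_mul]; linarith [hω.2])).sub_const L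
    simpa using this
  · have hd : Complex.exp (Complex.I * (-(Real.pi / 4) : ℝ)) *
        Complex.exp (Real.pi * Complex.I / 4) = 1 := by
      rw [← Complex.exp_add, ← Complex.exp_zero]
      congr 1
      push_cast
      ring
    have := (h2 (Complex.exp (Complex.I * (-(Real.pi / 4) : ℝ)))
      (by rw [hd]; simp [quarterSector]) (by rw [hd]; simp)).sub_const L
    simpa using this
  · convert h3 x hx using 2
    rw [weberW3Deriv]
    ring

theorem differentiable_weberW (a : ℝ) : Differentiable ℂ (weberW a) := by
  have h0 : Differentiable ℂ (weberWj 0 a) := fun z => (hasDerivAt_weberWj_zero a z).differentiableAt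
  have h3 : Differentiable ℂ (weberWj 3 a) :=
    fun z => (hasDerivAt_weberWj_three a z).differentiableAt
  exact ((h0.const_mul _).add (h3.const_mul _)).const_mul _

theorem hasDerivAt_weberW_primitive {a : ℝ} {G₀ G₃ : ℂ → ℂ}
    (h₀ : ∀ z, HasDerivAt G₀ (weberWj 0 a z) z) (h₃ : ∀ z, HasDerivAt G₃ (weberWj 3 a z) z)
    (z : ℂ) :
    HasDerivAt (fun z => weberAmplitude a * (Complex.exp (Complex.I * weberRho a) * G₀ z +
      Complex.exp (-(Complex.I * weberRho a)) * G₃ z)) (weberW a z) z := by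
  rw [weberW_eq]
  exact (((h₀ z).const_mul _).add ((h₃ z).const_mul _)).const_mul _

theorem hasDerivAt_weberW_neg_primitive {a : ℝ} {G₀ G₃ : ℂ → ℂ}
    (h₀ : ∀ z, HasDerivAt G₀ (weberWj 0 a z) z) (h₃ : ∀ z, HasDerivAt G₃ (weberWj 3 a z) z)
    (z : ℂ) :
    HasDerivAt (fun z => -Complex.I * (weberAmplitude a / weberK a) *
      (Complex.exp (Complex.I * weberRho a) * G₀ z -
        Complex.exp (-(Complex.I * weberRho a)) * G₃ z)) (weberW a (-z)) z := by
  rw [weberW_neg]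
  exact (((h₀ z).const_mul _).sub ((h₃ z).const_mul _)).const_mul _

/-- `i e^{πa/2} (W_3 G₀ - W_0 G₃)`, which is `W_0^{(0,3)}` and `N̂_W` when `G₀` and `G₃` are the
primitives of `W_0` and `W_3` that vanish at infinity. -/
def nieldOfPrimitives (a : ℝ) (G₀ G₃ : ℂ → ℂ) (z : ℂ) : ℂ :=
  Complex.I * (Real.exp (Real.pi * a / 2) : ℝ) * (weberWj 3 a z * G₀ z - weberWj 0 a z * G₃ z)

/-- The derivative of `nieldOfPrimitives`. -/
def nieldOfPrimitivesDeriv (a : ℝ) (G₀ G₃ : ℂ → ℂ) (z : ℂ) : ℂ :=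
  Complex.I * (Real.exp (Real.pi * a / 2) : ℝ) *
    (weberW3Deriv a z * G₀ z - weberW0Deriv a z * G₃ z)

theorem normalized_wronskian (a : ℝ) (z : ℂ) :
    Complex.I * (Real.exp (Real.pi * a / 2) : ℝ) *
      (weberWj 0 a z * weberW3Deriv a z - weberW0Deriv a z * weberWj 3 a z) = 1 := by
  have h : Complex.exp (Real.pi * a / 2) * Complex.exp (-(Real.pi * a / 2)) = 1 := by
    rw [← Complex.exp_add, add_neg_cancel, Complex.exp_zero]
  rw [weberWj_wronskian]
  push_cast
  linear_combination (-Complex.I ^ 2) * h - Complex.I_sq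

theorem hasDerivAt_nieldOfPrimitives {a : ℝ} {G₀ G₃ : ℂ → ℂ}
    (h₀ : ∀ z, HasDerivAt G₀ (weberWj 0 a z) z) (h₃ : ∀ z, HasDerivAt G₃ (weberWj 3 a z) z)
    (z : ℂ) :
    HasDerivAt (nieldOfPrimitives a G₀ G₃) (nieldOfPrimitivesDeriv a G₀ G₃ z) z := by
  refine ((((hasDerivAt_weberWj_three a z).mul (h₀ z)).sub
    ((hasDerivAt_weberWj_zero a z).mul (h₃ z))).const_mul _).congr_deriv ?_
  rw [nieldOfPrimitivesDeriv]
  ring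

theorem hasDerivAt_nieldOfPrimitivesDeriv {a : ℝ} {G₀ G₃ : ℂ → ℂ}
    (h₀ : ∀ z, HasDerivAt G₀ (weberWj 0 a z) z) (h₃ : ∀ z, HasDerivAt G₃ (weberWj 3 a z) z)
    (z : ℂ) :
    HasDerivAt (nieldOfPrimitivesDeriv a G₀ G₃)
      (1 - (z ^ 2 / 4 - a) * nieldOfPrimitives a G₀ G₃ z) z := by
  refine ((((hasDerivAt_weberW3Deriv a z).mul (h₀ z)).sub
    ((hasDerivAt_weberW0Deriv a z).mul (h₃ z))).const_mul _).congr_deriv ?_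
  rw [nieldOfPrimitives]
  linear_combination normalized_wronskian a z

/-- Expanding both products with the connection formula leaves the mixed terms only. -/
theorem weberW_mul_sub_weberW_neg_mul (a : ℝ) (G₀ G₃ : ℂ → ℂ) (z : ℂ) :
    weberW a z * (-(-Complex.I * (weberAmplitude a / weberK a) *
      (Complex.exp (Complex.I * weberRho a) * G₀ z -
        Complex.exp (-(Complex.I * weberRho a)) * G₃ z))) -
    weberW a (-z) * (-(weberAmplitude a * (Complex.exp (Complex.I * weberRho a) * G₀ z +
      Complex.exp (-(Complex.I * weberRho a)) * G₃ z))) = nieldOfPrimitives a G₀ G₃ z := by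
  have hk : (weberK a : ℂ) ≠ 0 := by exact_mod_cast (weberK_pos a).ne'
  have hA : (weberAmplitude a : ℂ) ^ 2 =
      weberK a / 2 * (Real.exp (Real.pi * a / 2) : ℝ) := by
    exact_mod_cast weberAmplitude_sq a
  have hee : Complex.exp (Complex.I * weberRho a) *
      Complex.exp (-(Complex.I * weberRho a)) = 1 := by
    rw [← Complex.exp_add, add_neg_cancel, Complex.exp_zero]
  rw [weberW_neg, weberW_eq, nieldOfPrimitives]
  set e := Complex.exp (Complex.I * weberRho a)
  set e' := Complex.exp (-(Complex.I * weberRho a))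
  calc _ = 2 * Complex.I * ((weberAmplitude a : ℂ) ^ 2 / weberK a) * (e * e') *
        (weberWj 3 a z * G₀ z - weberWj 0 a z * G₃ z) := by ring
    _ = _ := by
      rw [hA, hee]
      field_simp

/-! ### The real axis: asymptotics and uniqueness -/

theorem exists_bound_weberWj_zero (a : ℝ) : ∃ C : ℝ, ∀ x : ℝ, 0 ≤ x →
    ‖weberWj 0 a x‖ ≤ C ∧ ‖weberW0Deriv a x‖ ≤ C * (1 + x) := by
  rw [weberWj_zero]
  refine exists_bound_rotatedU (neg_half_lt_re_I_mul a) exp_neg_pi_I_div_four_mem.1 ?_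
  rw [Complex.norm_exp]
  simp [show (4 : ℂ) = ((4 : ℝ) : ℂ) by norm_num, Complex.div_ofReal_re, -Complex.ofReal_ofNat]

theorem exists_bound_weberWj_three (a : ℝ) : ∃ C : ℝ, ∀ x : ℝ, 0 ≤ x →
    ‖weberWj 3 a x‖ ≤ C ∧ ‖weberW3Deriv a x‖ ≤ C * (1 + x) := by
  rw [weberWj_three]
  refine exists_bound_rotatedU (neg_half_lt_re_neg_I_mul a) exp_pi_I_div_four_mem.1 ?_
  rw [Complex.norm_exp]
  simp [show (4 : ℂ) = ((4 : ℝ) : ℂ) by norm_num, Complex.div_ofReal_re, -Complex.ofReal_ofNat]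

/-- The oscillating leading terms of the two primitives combine to the Wronskian of `W_0` and
`W_3`, so that only `nieldSeries` and an error `O(x⁻³)` remain. -/
theorem isEquivalent_nieldOfPrimitives {a : ℝ} {G₀ G₃ : ℂ → ℂ} {K₀ K₃ : ℝ}
    (h₀ : ∀ x : ℝ, 2 ≤ x → ‖G₀ x - (nieldSeriesDeriv a x * weberWj 0 a x -
      nieldSeries a x * weberW0Deriv a x)‖ ≤ K₀ / x ^ 3)
    (h₃ : ∀ x : ℝ, 2 ≤ x → ‖G₃ x - (nieldSeriesDeriv a x * weberWj 3 a x -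
      nieldSeries a x * weberW3Deriv a x)‖ ≤ K₃ / x ^ 3) :
    (fun x : ℝ => nieldOfPrimitives a G₀ G₃ x) ~[atTop] (fun x : ℝ => 4 / (x : ℂ) ^ 2) := by
  obtain ⟨C₀, hC₀⟩ := exists_bound_weberWj_zero a
  obtain ⟨C₃, hC₃⟩ := exists_bound_weberWj_three a
  set c := Real.exp (Real.pi * a / 2) with hc
  set M := c * (C₃ * K₀ + C₀ * K₃) + ‖(16 * a : ℂ)‖ with hM
  have hbound : ∀ x : ℝ, 2 ≤ x → ‖nieldOfPrimitives a G₀ G₃ x - 4 / (x : ℂ) ^ 2‖ ≤ M / x ^ 3 := by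
    intro x hx
    have hx0 : 0 < x := by linarith
    have b0 := (hC₀ x hx0.le).1
    have b3 := (hC₃ x hx0.le).1
    set E₀ := G₀ x - (nieldSeriesDeriv a x * weberWj 0 a x - nieldSeries a x * weberW0Deriv a x)
    set E₃ := G₃ x - (nieldSeriesDeriv a x * weberWj 3 a x - nieldSeries a x * weberW3Deriv a x)
    have hsplit : nieldOfPrimitives a G₀ G₃ x - 4 / (x : ℂ) ^ 2 =
        Complex.I * (c : ℝ) * (weberWj 3 a x * E₀ - weberWj 0 a x * E₃) +
          16 * a / (x : ℂ) ^ 4 := by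
      have hp : nieldSeries a x = 4 / (x : ℂ) ^ 2 + 16 * a / (x : ℂ) ^ 4 := rfl
      have hw := normalized_wronskian a x
      rw [← hc] at hw
      rw [nieldOfPrimitives, ← hc]
      linear_combination nieldSeries a x * hw + hp
    rw [hsplit]
    refine (norm_add_le _ _).trans ?_
    rw [hM, add_div]
    refine add_le_add ?_ ?_
    · rw [norm_mul, norm_mul, Complex.norm_I, one_mul, Complex.norm_real,
        Real.norm_of_nonneg (Real.exp_pos _).le, mul_div_assoc c]
      refine mul_le_mul_of_nonneg_left ?_ (Real.exp_pos _).le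
      refine (norm_sub_le _ _).trans ?_
      rw [norm_mul, norm_mul, add_div, mul_div_assoc, mul_div_assoc]
      exact add_le_add
        (mul_le_mul b3 (h₀ x hx) (norm_nonneg _) ((norm_nonneg _).trans b3))
        (mul_le_mul b0 (h₃ x hx) (norm_nonneg _) ((norm_nonneg _).trans b0))
    · rw [norm_div, norm_pow, Complex.norm_real, Real.norm_of_nonneg hx0.le]
      gcongr
      · linarith
      · norm_num
  rw [IsEquivalent, isLittleO_iff]
  intro ε hε
  filter_upwards [eventually_ge_atTop 2, eventually_ge_atTop (M / (4 * ε))] with x hx hx'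
  have hx0 : 0 < x := by linarith
  refine (hbound x hx).trans ?_
  rw [norm_div, norm_pow, Complex.norm_real, Real.norm_of_nonneg hx0.le, Complex.norm_ofNat,
    ← mul_div_assoc, div_le_div_iff₀ (by positivity) (by positivity)]
  rw [div_le_iff₀ (by positivity)] at hx'
  calc M * x ^ 2 ≤ x * (4 * ε) * x ^ 2 := by gcongr
    _ = ε * 4 * x ^ 3 := by ring

/-- If `f` and `f''` tend to `0` at `+∞`, then so does `f'`. -/
theorem tendsto_deriv_zero {f f' f'' : ℝ → ℂ} (hf : ∀ x, HasDerivAt f (f' x) x)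
    (hf' : ∀ x, HasDerivAt f' (f'' x) x) (h : Tendsto f atTop (𝓝 0))
    (h'' : Tendsto f'' atTop (𝓝 0)) : Tendsto f' atTop (𝓝 0) := by
  rw [Metric.tendsto_atTop] at h h'' ⊢
  intro ε hε
  obtain ⟨X, hX⟩ := h (ε / 4) (by positivity)
  obtain ⟨Y, hY⟩ := h'' (ε / 4) (by positivity)
  simp only [dist_zero_right] at hX hY ⊢
  refine ⟨max X Y, fun x hx => ?_⟩
  have hxX : X ≤ x := (le_max_left _ _).trans hx
  have hxY : Y ≤ x := (le_max_right _ _).trans hx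
  have h1 : ∀ t ∈ Set.Icc x (x + 1), ‖f' t - f' x‖ ≤ ε / 4 := by
    intro t ht
    have h2 := Convex.norm_image_sub_le_of_norm_hasDerivWithin_le (f := f') (f' := f'')
      (C := ε / 4) (s := Set.Icc x (x + 1)) (fun u _ => (hf' u).hasDerivWithinAt)
      (fun u hu => (hY u (hxY.trans hu.1)).le) (convex_Icc _ _)
      (Set.left_mem_Icc.mpr (by linarith)) ht
    refine h2.trans ?_
    rw [Real.norm_of_nonneg (by linarith [ht.1])]
    nlinarith [ht.2]
  have h3 := Convex.norm_image_sub_le_of_norm_hasDerivWithin_le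
    (f := fun t : ℝ => f t - t * f' x) (f' := fun t => f' t - f' x)
    (C := ε / 4) (s := Set.Icc x (x + 1))
    (fun u _ => (((hf u).sub (((hasDerivAt_id (u : ℂ)).mul_const (f' x)).comp_ofReal)).congr_deriv
      (by simp)).hasDerivWithinAt)
    h1 (convex_Icc _ _) (Set.left_mem_Icc.mpr (by linarith))
    (Set.right_mem_Icc.mpr (by linarith : x ≤ x + 1))
  rw [show x + 1 - x = 1 by ring, norm_one, mul_one] at h3
  have h4 := hX x hxX
  have h5 := hX (x + 1) (by linarith)
  have h6 : f' x = f (x + 1) - f x -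
      (f (x + 1) - ((x + 1 : ℝ) : ℂ) * f' x - (f x - (x : ℂ) * f' x)) := by
    push_cast
    ring
  calc ‖f' x‖ ≤ ‖f (x + 1)‖ + ‖f x‖ + ε / 4 := by
        rw [h6]
        exact (norm_sub_le _ _).trans (add_le_add (norm_sub_le _ _) (by simpa using h3))
    _ < ε := by linarith

/-- A solution of Weber's equation on the real line that is `o(x⁻²)` at `+∞` vanishes: its
derivative tends to `0` there, hence so do its (constant) Wronskians with `W_0` and `W_3`. -/
theorem eq_zero_of_isLittleO {a : ℝ} {f f' : ℝ → ℂ} (hf : ∀ x, HasDerivAt f (f' x) x)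
    (hf' : ∀ x : ℝ, HasDerivAt f' ((a - (x : ℂ) ^ 2 / 4) * f x) x)
    (hfo : f =o[atTop] fun x : ℝ => -4 / (x : ℂ) ^ 2) (x : ℝ) : f x = 0 := by
  have hinv : Tendsto (fun x : ℝ => ((x : ℂ) ^ 2)⁻¹) atTop (𝓝 0) := by
    rw [tendsto_zero_iff_norm_tendsto_zero]
    have : Tendsto (fun x : ℝ => (x ^ 2)⁻¹) atTop (𝓝 0) :=
      (tendsto_pow_atTop two_ne_zero).inv_tendsto_atTop
    simpa using this
  have hq : Tendsto (fun x : ℝ => (x : ℂ) ^ 2 * f x) atTop (𝓝 0) := by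
    have := hfo.tendsto_div_nhds_zero.const_mul (-4)
    rw [mul_zero] at this
    refine this.congr' ?_
    filter_upwards [eventually_gt_atTop 0] with x hx
    have : (x : ℂ) ≠ 0 := by exact_mod_cast hx.ne'
    field_simp
  have hf0 : Tendsto f atTop (𝓝 0) := by
    have := hinv.mul hq
    rw [mul_zero] at this
    refine this.congr' ?_
    filter_upwards [eventually_gt_atTop 0] with x hx
    have : (x : ℂ) ≠ 0 := by exact_mod_cast hx.ne'
    field_simp
  have hf2 : Tendsto (fun x : ℝ => (a - (x : ℂ) ^ 2 / 4) * f x) atTop (𝓝 0) := by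
    have := (hf0.const_mul (a : ℂ)).sub (hq.div_const 4)
    simp only [mul_zero, zero_div, sub_zero] at this
    exact this.congr fun x => by ring
  have hf1 := tendsto_deriv_zero hf hf' hf0 hf2
  have hwr : ∀ {g g' : ℂ → ℂ}, (∀ z, HasDerivAt g (g' z) z) →
      (∀ z, HasDerivAt g' ((a - z ^ 2 / 4) * g z) z) →
      (∃ C : ℝ, ∀ x : ℝ, 0 ≤ x → ‖g x‖ ≤ C ∧ ‖g' x‖ ≤ C * (1 + x)) →
      f x * g' x - f' x * g x = 0 := by
    rintro g g' hg hg' ⟨C, hC⟩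
    have hd : ∀ x : ℝ, HasDerivAt (fun x : ℝ => f x * g' x - f' x * g x) 0 x := fun x =>
      (((hf x).mul (hg' x).comp_ofReal).sub ((hf' x).mul (hg x).comp_ofReal)).congr_deriv
        (by ring)
    have hconst : ∀ y : ℝ, f y * g' y - f' y * g y = f x * g' x - f' x * g x := fun y =>
      is_const_of_deriv_eq_zero (fun t => (hd t).differentiableAt) (fun t => (hd t).deriv) y x
    have hlim : Tendsto (fun y : ℝ => f y * g' y - f' y * g y) atTop (𝓝 0) := by
      rw [tendsto_zero_iff_norm_tendsto_zero]
      have hmaj : Tendsto (fun y : ℝ => ‖(y : ℂ) ^ 2 * f y‖ * (2 * C) + ‖f' y‖ * C) atTop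
          (𝓝 0) := by
        have := (hq.norm.mul_const (2 * C)).add (hf1.norm.mul_const C)
        simpa using this
      refine squeeze_zero' (Eventually.of_forall fun _ => norm_nonneg _) ?_ hmaj
      filter_upwards [eventually_ge_atTop 1] with y hy
      have hy0 : 0 ≤ y := by linarith
      obtain ⟨c1, c2⟩ := hC y hy0
      have hC0 : 0 ≤ C := (norm_nonneg _).trans c1
      refine (norm_sub_le _ _).trans ?_
      rw [norm_mul, norm_mul, norm_mul, norm_pow, Complex.norm_real, Real.norm_of_nonneg hy0]
      refine add_le_add ?_ (mul_le_mul_of_nonneg_left c1 (norm_nonneg _))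
      calc ‖f y‖ * ‖g' y‖ ≤ ‖f y‖ * (C * (2 * y ^ 2)) := by
            gcongr
            refine c2.trans ?_
            gcongr
            nlinarith
        _ = y ^ 2 * ‖f y‖ * (2 * C) := by ring
    exact tendsto_nhds_unique ((tendsto_const_nhds).congr fun y => (hconst y).symm) hlim
  have w0 := hwr (hasDerivAt_weberWj_zero a) (hasDerivAt_weberW0Deriv a)
    (exists_bound_weberWj_zero a)
  have w3 := hwr (hasDerivAt_weberWj_three a) (hasDerivAt_weberW3Deriv a)
    (exists_bound_weberWj_three a)
  have hw := normalized_wronskian a x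
  linear_combination (-f x) * hw + Complex.I * (Real.exp (Real.pi * a / 2) : ℝ) *
    (weberWj 0 a x * w3 - weberWj 3 a x * w0)

/-- Entire functions that agree on the real line are equal. -/
theorem eq_of_eq_ofReal {F G : ℂ → ℂ} (hF : Differentiable ℂ F) (hG : Differentiable ℂ G)
    (h : ∀ x : ℝ, F x = G x) : F = G := by
  refine AnalyticOnNhd.eq_of_frequently_eq (z₀ := 0)
    (fun z _ => hF.analyticAt z) (fun z _ => hG.analyticAt z) ?_
  have hlim : Tendsto (fun n : ℕ => ((1 / ((n : ℝ) + 1) : ℝ) : ℂ)) atTop (𝓝[≠] 0) := by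
    refine tendsto_nhdsWithin_iff.mpr ⟨?_, Eventually.of_forall fun n => ?_⟩
    · have := (Complex.continuous_ofReal.tendsto 0).comp
        (tendsto_one_div_add_atTop_nhds_zero_nat (𝕜 := ℝ))
      rwa [Complex.ofReal_zero] at this
    · have : (1 / ((n : ℝ) + 1) : ℝ) ≠ 0 := by positivity
      exact Complex.ofReal_ne_zero.mpr this
  exact hlim.frequently (Frequently.of_forall fun n => h _)

end NieldKuznetsov

end

open NieldKuznetsov

theorem theorem2p1 (a : ℝ) :
    (∀ x : ℝ, NieldKuznetsov.ImproperConverges (fun t => NieldKuznetsov.weberW a t) x ∧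
      NieldKuznetsov.ImproperConverges (fun t => NieldKuznetsov.weberW a (-t)) x) ∧
    (∀ z : ℂ, NieldKuznetsov.ContourConverges (fun t => NieldKuznetsov.weberW a t) 0 z ∧
      NieldKuznetsov.ContourConverges (fun t => NieldKuznetsov.weberW a (-t)) 0 z ∧
      NieldKuznetsov.ContourConverges (fun t => NieldKuznetsov.weberWj 0 a t) (Real.pi / 4) z ∧
      NieldKuznetsov.ContourConverges (fun t => NieldKuznetsov.weberWj 3 a t) (-(Real.pi / 4)) z) ∧
    -- the analytic continuation of the real function, and its identification
    Differentiable ℂ (NieldKuznetsov.weberW a) ∧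
    Differentiable ℂ (NieldKuznetsov.nieldHatC a) ∧
    (∀ x : ℝ, NieldKuznetsov.nieldHatC a x = NieldKuznetsov.nieldHat a x) ∧
    (∀ F : ℂ → ℂ, Differentiable ℂ F → (∀ x : ℝ, F x = NieldKuznetsov.nieldHat a x) →
      F = NieldKuznetsov.nieldHatC a) ∧
    (∀ z : ℂ, NieldKuznetsov.nieldHatC a z = NieldKuznetsov.weberW03 0 a z) ∧
    -- the inhomogeneous equation, the behaviour at infinity and uniqueness
    (∀ z : ℂ, deriv (deriv (NieldKuznetsov.weberW03 0 a)) z +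
      (z ^ 2 / 4 - a) * NieldKuznetsov.weberW03 0 a z = 1) ∧
    (fun x : ℝ => NieldKuznetsov.nieldHat a x) ~[atTop] (fun x : ℝ => 4 / (x : ℂ) ^ 2) ∧
    NieldKuznetsov.SolvesInhomogeneousWeber a (fun x => -NieldKuznetsov.nieldHat a x) ∧
    (∀ y : ℝ → ℂ, NieldKuznetsov.SolvesInhomogeneousWeber a y →
      y ~[atTop] (fun x : ℝ => -4 / (x : ℂ) ^ 2) →
      y = fun x => -NieldKuznetsov.nieldHat a x) := by
  obtain ⟨G₀, K₀, hG₀, hr₀, hc₀, hE₀⟩ := exists_primitive_weberWj_zero a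
  obtain ⟨G₃, K₃, hG₃, hr₃, hc₃, hE₃⟩ := exists_primitive_weberWj_three a
  have hΦ := hasDerivAt_weberW_primitive hG₀ hG₃
  have hΨ := hasDerivAt_weberW_neg_primitive hG₀ hG₃
  set Φ : ℂ → ℂ := fun z => weberAmplitude a * (Complex.exp (Complex.I * weberRho a) * G₀ z +
    Complex.exp (-(Complex.I * weberRho a)) * G₃ z)
  set Ψ : ℂ → ℂ := fun z => -Complex.I * (weberAmplitude a / weberK a) *
    (Complex.exp (Complex.I * weberRho a) * G₀ z -
      Complex.exp (-(Complex.I * weberRho a)) * G₃ z)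
  have hΦlim : Tendsto (fun R : ℝ => Φ R) atTop (𝓝 0) := by
    have := ((hr₀.const_mul (Complex.exp (Complex.I * weberRho a))).add
      (hr₃.const_mul (Complex.exp (-(Complex.I * weberRho a))))).const_mul (weberAmplitude a : ℂ)
    simpa using this
  have hΨlim : Tendsto (fun R : ℝ => Ψ R) atTop (𝓝 0) := by
    have := ((hr₀.const_mul (Complex.exp (Complex.I * weberRho a))).sub
      (hr₃.const_mul (Complex.exp (-(Complex.I * weberRho a))))).const_mul
        (-Complex.I * (weberAmplitude a / weberK a))
    simpa only [mul_zero, sub_zero] using this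
  -- the contours for `W` run along the positive real axis, the ray of angle `0`
  have hray : ∀ R : ℝ, (R : ℂ) * Complex.exp (Complex.I * (0 : ℝ)) = R := fun R => by simp
  have hΦlim' : Tendsto (fun R : ℝ => Φ (R * Complex.exp (Complex.I * (0 : ℝ)))) atTop (𝓝 0) := by
    simpa only [hray] using hΦlim
  have hΨlim' : Tendsto (fun R : ℝ => Ψ (R * Complex.exp (Complex.I * (0 : ℝ)))) atTop (𝓝 0) := by
    simpa only [hray] using hΨlim
  have cW : Continuous fun t => weberW a t := (differentiable_weberW a).continuous
  have cW' : Continuous fun t => weberW a (-t) := cW.comp continuous_neg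
  have c0 : Continuous fun t => weberWj 0 a t :=
    continuous_iff_continuousAt.mpr fun z => (hasDerivAt_weberWj_zero a z).continuousAt
  have c3 : Continuous fun t => weberWj 3 a t :=
    continuous_iff_continuousAt.mpr fun z => (hasDerivAt_weberWj_three a z).continuousAt
  have iW := tendsto_intervalIntegral_of_primitive cW hΦ hΦlim
  have iW' := tendsto_intervalIntegral_of_primitive cW' hΨ hΨlim
  have hC : nieldHatC a = nieldOfPrimitives a G₀ G₃ := by
    ext z
    rw [nieldHatC, contourFromInfinity_eq cW hΦ hΦlim', contourFromInfinity_eq cW' hΨ hΨlim',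
      sub_zero, sub_zero]
    exact weberW_mul_sub_weberW_neg_mul a G₀ G₃ z
  have hR : ∀ x : ℝ, nieldHat a x = nieldOfPrimitives a G₀ G₃ x := by
    intro x
    have e1 : improperIntegral (fun t => weberW a t) x = 0 - Φ x := (iW x).limUnder_eq
    have e2 : improperIntegral (fun t => weberW a (-t)) x = 0 - Ψ x := by
      refine Eq.trans ?_ (iW' x).limUnder_eq
      simp [improperIntegral]
    rw [nieldHat, e1, e2, zero_sub, zero_sub]
    exact weberW_mul_sub_weberW_neg_mul a G₀ G₃ x
  have h03 : weberW03 0 a = nieldOfPrimitives a G₀ G₃ := by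
    ext z
    simp only [weberW03, pow_zero, one_mul]
    rw [contourFromInfinity_eq c0 hG₀ hc₀, contourFromInfinity_eq c3 hG₃ hc₃, sub_zero, sub_zero,
      nieldOfPrimitives]
  have hd := hasDerivAt_nieldOfPrimitives hG₀ hG₃
  have hd' := hasDerivAt_nieldOfPrimitivesDeriv hG₀ hG₃
  have hdiff : Differentiable ℂ (nieldOfPrimitives a G₀ G₃) := fun z => (hd z).differentiableAt
  have heq := isEquivalent_nieldOfPrimitives hE₀ hE₃
  have hsol : ∀ x : ℝ, HasDerivAt (fun x : ℝ => -nieldHat a x)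
      (-nieldOfPrimitivesDeriv a G₀ G₃ x) x ∧
      HasDerivAt (fun x : ℝ => -nieldOfPrimitivesDeriv a G₀ G₃ x)
        (-1 - ((x : ℂ) ^ 2 / 4 - a) * -nieldHat a x) x := by
    intro x
    simp only [hR]
    exact ⟨(hd x).comp_ofReal.fun_neg, (hd' x).comp_ofReal.fun_neg.congr_deriv (by ring)⟩
  have hequiv : (fun x : ℝ => nieldHat a x) ~[atTop] (fun x : ℝ => 4 / (x : ℂ) ^ 2) := by
    simpa only [hR] using heq
  refine ⟨fun x => ⟨⟨_, iW x⟩, ⟨0 - Ψ x, ?_⟩⟩, fun z => ⟨⟨_, tendsto_segmentIntegral cW hΦ hΦlim' z⟩,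
    ⟨_, tendsto_segmentIntegral cW' hΨ hΨlim' z⟩, ⟨_, tendsto_segmentIntegral c0 hG₀ hc₀ z⟩,
    ⟨_, tendsto_segmentIntegral c3 hG₃ hc₃ z⟩⟩, differentiable_weberW a, hC ▸ hdiff,
    fun x => by rw [hC, hR], fun F hF h => ?_, fun z => by rw [hC, h03], fun z => ?_, hequiv,
    ⟨_, hsol⟩, fun y hy hy' => ?_⟩
  · simpa using iW' x
  · rw [hC]
    exact eq_of_eq_ofReal hF hdiff fun x => by rw [h, hR]
  · rw [h03, show deriv (nieldOfPrimitives a G₀ G₃) = nieldOfPrimitivesDeriv a G₀ G₃ from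
      funext fun z => (hd z).deriv, (hd' z).deriv]
    ring
  · obtain ⟨y', hy1⟩ := hy
    have hneg : (fun x : ℝ => -nieldHat a x) ~[atTop] (fun x : ℝ => -4 / (x : ℂ) ^ 2) := by
      have := hequiv.neg
      simpa only [neg_div] using this
    have ho : (fun x : ℝ => y x - -nieldHat a x) =o[atTop] fun x : ℝ => -4 / (x : ℂ) ^ 2 :=
      (hy'.isLittleO.sub hneg.isLittleO).congr_left fun x => by simp
    funext x
    exact sub_eq_zero.mp (eq_zero_of_isLittleO (a := a) (f := fun x => y x - -nieldHat a x)
      (fun x => (hy1 x).1.sub (hsol x).1)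
      (fun x => ((hy1 x).2.sub (hsol x).2).congr_deriv (by ring)) ho x)
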